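/- Let $p$ be a prime number and let $E$ be a finite extension of $\mathbf{Q}_p$. Let $\mathcal{R}$ be the Robba ring over $\mathbf{Q}_p$, that is, the ring of series $f(X)=\sum_{i\in\mathbf{Z}}a_iX^i$ with $a_i\in\mathbf{Q}_p$ which converge on some annulus $0<v_p(z)\le 1/r$ ($r>0$ depending on $f$), and let $\mathcal{R}^+\subset\mathcal{R}$ be the subring of power series $f(X)=\sum_{i\ge 0}a_iX^i$ with $a_i\in\mathbf{Q}_p$ which converge on the open unit disk. Let $t=\log(1+X)=\sum_{n\ge1}(-1)^{n+1}X^n/n\in\mathcal{R}^+$. Let $\varphi$ be the Frobenius $f(X)\mapsto f((1+X)^p-1)$ on $\mathcal{R}$ and $\mathcal{R}^+$, extended to $\mathcal{R}[1/t]$ and $\mathcal{R}^+[1/t]$ (note that $\varphi(t)=pt$), and then $E$-linearly to $E\otimes_{\mathbf{Q}_p}\mathcal{R}[1/t]$ and $E\otimes_{\mathbf{Q}_p}\mathcal{R}^+[1/t]$. In each of the last two rings $A$, every $y\in A$ can be written as $y=\sum_{i=0}^{p-1}\varphi(y_i)(1+X)^i$ with uniquely determined $y_0,\dots,y_{p-1}\in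 A$; one defines $\psi(y)=y_0$. The natural map $E\otimes_{\mathbf{Q}_p}\mathcal{R}^+[1/t]\to E\otimes_{\mathbf{Q}_p}\mathcal{R}[1/t]$ is injective, and for every $\alpha\in E^\times$, viewing the source as a subring of the target, \[ (E\otimes_{\mathbf{Q}_p}\mathcal{R}[1/t])^{\psi=\alpha}=(E\otimes_{\mathbf{Q}_p}\mathcal{R}^+[1/t])^{\psi=\alpha}, \] where the superscript $\psi=\alpha$ denotes the set of elements $f$ with $\psi(f)=\alpha f$. -/

import Mathlib

open Filter Topology
open scoped TensorProduct

namespace Robba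

/-- The bi-infinite series `∑ aₙ zⁿ` converges at the points `z` of absolute value `σ`:
its terms tend to `0` as `n → +∞` and as `n → -∞`. -/
def ConvergesAt {p : ℕ} [Fact p.Prime] (a : ℤ → ℚ_[p]) (σ : ℝ) : Prop :=
  Tendsto (fun n : ℤ => ‖a n‖ * σ ^ n) cofinite (𝓝 0)

/-- Coefficients of the product of two bi-infinite series. -/
noncomputable def mulCoeff {p : ℕ} [Fact p.Prime] (a b : ℤ → ℚ_[p]) (n : ℤ) : ℚ_[p] :=
  ∑' k : ℤ, a k * b (n - k)

theorem summable_of_weight {p : ℕ} [Fact p.Prime] {ι : Type*} {F : ι → ℚ_[p]} {G : ι → ℝ} (c : ℝ)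
    (hG : Tendsto G cofinite (𝓝 0)) (h : ∀ i, ‖F i‖ ≤ c * G i) : Summable F := by
  apply NonarchimedeanAddGroup.summable_of_tendsto_cofinite_zero
  apply squeeze_zero_norm h
  simpa using hG.const_mul c

theorem convergesAt_tsum {p : ℕ} [Fact p.Prime] {κ : Type*} {F : ℤ → κ → ℚ_[p]} {σ : ℝ}
    (hσ : 0 < σ) (h : Tendsto (fun x : ℤ × κ => ‖F x.1 x.2‖ * σ ^ x.1) cofinite (𝓝 0)) :
    ConvergesAt (fun n => ∑' k, F n k) σ := by
  unfold ConvergesAt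
  rw [Metric.tendsto_nhds] at h ⊢
  intro ε hε
  have h1 := h (ε / 2) (half_pos hε)
  rw [eventually_cofinite] at h1 ⊢
  refine (h1.image Prod.fst).subset ?_
  intro n hn
  by_contra hcon
  apply hn
  have hp : 0 < σ ^ n := zpow_pos hσ n
  have hb : ∀ k, ‖F n k‖ ≤ ε / 2 / σ ^ n := by
    intro k
    by_contra hk
    apply hcon
    refine ⟨(n, k), ?_, rfl⟩
    simp only [Set.mem_ofPred_eq, dist_zero_right, not_lt]
    rw [not_le, div_lt_iff₀ hp] at hk
    rw [Real.norm_of_nonneg (by positivity)]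
    exact hk.le
  have h2 := IsUltrametricDist.norm_tsum_le_of_forall_le_of_nonneg (f := F n)
    (by positivity) hb
  rw [le_div_iff₀ hp] at h2
  rw [dist_zero_right, Real.norm_of_nonneg (by positivity)]
  linarith

theorem tendsto_mul_weight {p : ℕ} [Fact p.Prime] {a b : ℤ → ℚ_[p]} {σ : ℝ} (hσ : 0 < σ)
    (ha : ConvergesAt a σ) (hb : ConvergesAt b σ) :
    Tendsto (fun x : ℤ × ℤ => ‖a x.2 * b (x.1 - x.2)‖ * σ ^ x.1) cofinite (𝓝 0) := by
  have h := tendsto_mul_cofinite_nhds_zero ha hb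
  have hinj : Function.Injective (fun x : ℤ × ℤ => (x.2, x.1 - x.2)) := by
    rintro ⟨x1, x2⟩ ⟨y1, y2⟩ hxy
    simp only [Prod.mk.injEq] at hxy ⊢
    omega
  refine (h.comp hinj.tendsto_cofinite).congr ?_
  rintro ⟨n, k⟩
  simp only [Function.comp, norm_mul]
  have : σ ^ n = σ ^ k * σ ^ (n - k) := by rw [← zpow_add₀ hσ.ne']; congr 1; ring
  rw [this]; ring

theorem ConvergesAt.mul {p : ℕ} [Fact p.Prime] {a b : ℤ → ℚ_[p]} {σ : ℝ} (hσ : 0 < σ)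
    (ha : ConvergesAt a σ) (hb : ConvergesAt b σ) : ConvergesAt (mulCoeff a b) σ :=
  convergesAt_tsum (F := fun n k => a k * b (n - k)) hσ (tendsto_mul_weight hσ ha hb)

theorem ConvergesAt.summable {p : ℕ} [Fact p.Prime] {a b : ℤ → ℚ_[p]} {σ : ℝ} (hσ : 0 < σ)
    (ha : ConvergesAt a σ) (hb : ConvergesAt b σ) (n : ℤ) :
    Summable (fun k => a k * b (n - k)) := by
  have h := (tendsto_mul_weight hσ ha hb).comp (Prod.mk_right_injective n).tendsto_cofinite
  refine summable_of_weight (σ ^ n)⁻¹ h ?_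
  intro k
  have hp : 0 < σ ^ n := zpow_pos hσ n
  simp only [Function.comp]
  field_simp
  exact le_rfl

theorem ConvergesAt.add {p : ℕ} [Fact p.Prime] {a b : ℤ → ℚ_[p]} {σ : ℝ} (hσ : 0 < σ)
    (ha : ConvergesAt a σ) (hb : ConvergesAt b σ) : ConvergesAt (a + b) σ := by
  refine squeeze_zero (fun n => by positivity) (fun n => ?_) (by simpa using Tendsto.add ha hb)
  rw [← add_mul]
  exact mul_le_mul_of_nonneg_right (norm_add_le _ _) (by positivity)

theorem ConvergesAt.smul {p : ℕ} [Fact p.Prime] {a : ℤ → ℚ_[p]} {σ : ℝ} (r : ℚ_[p])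
    (ha : ConvergesAt a σ) : ConvergesAt (r • a) σ := by
  have h := Tendsto.const_mul ‖r‖ ha
  rw [mul_zero] at h
  refine h.congr fun n => ?_
  simp [mul_assoc]

theorem convergesAt_single {p : ℕ} [Fact p.Prime] (m : ℤ) (r : ℚ_[p]) (σ : ℝ) :
    ConvergesAt (Pi.single m r) σ := by
  apply tendsto_const_nhds.congr'
  rw [EventuallyEq, eventually_cofinite]
  refine (Set.finite_singleton m).subset fun n hn => ?_
  by_contra h
  apply hn
  simp [Pi.single_eq_of_ne h]

theorem mulCoeff_comm {p : ℕ} [Fact p.Prime] (a b : ℤ → ℚ_[p]) : mulCoeff a b = mulCoeff b a := by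
  ext n
  unfold mulCoeff
  rw [← (Equiv.subLeft n).tsum_eq]
  refine tsum_congr fun k => ?_
  simp [mul_comm]

theorem mulCoeff_single {p : ℕ} [Fact p.Prime] (m : ℤ) (r : ℚ_[p]) (b : ℤ → ℚ_[p]) (n : ℤ) :
    mulCoeff (Pi.single m r) b n = r * b (n - m) := by
  unfold mulCoeff
  rw [tsum_eq_single m]
  · simp
  · intro k hk
    simp [Pi.single_eq_of_ne hk]

theorem mulCoeff_assoc {p : ℕ} [Fact p.Prime] {a b c : ℤ → ℚ_[p]} {σ : ℝ} (hσ : 0 < σ)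
    (ha : ConvergesAt a σ) (hb : ConvergesAt b σ) (hc : ConvergesAt c σ) :
    mulCoeff (mulCoeff a b) c = mulCoeff a (mulCoeff b c) := by
  ext n
  have hp : 0 < σ ^ n := zpow_pos hσ n
  have hS : Summable (fun x : ℤ × ℤ => a x.1 * b (x.2 - x.1) * c (n - x.2)) := by
    have h := tendsto_mul_cofinite_nhds_zero ha (tendsto_mul_cofinite_nhds_zero hb hc)
    have hinj : Function.Injective
        (fun x : ℤ × ℤ => (x.1, (x.2 - x.1, n - x.2))) := by
      rintro ⟨x1, x2⟩ ⟨y1, y2⟩ hxy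
      simp only [Prod.mk.injEq] at hxy ⊢
      omega
    refine summable_of_weight (σ ^ n)⁻¹ (h.comp hinj.tendsto_cofinite) ?_
    rintro ⟨i, k⟩
    simp only [Function.comp, norm_mul]
    have : σ ^ n = σ ^ i * (σ ^ (k - i) * σ ^ (n - k)) := by
      rw [← zpow_add₀ hσ.ne', ← zpow_add₀ hσ.ne']; congr 1; ring
    rw [le_inv_mul_iff₀ hp, this]
    apply le_of_eq; ring
  have hL : mulCoeff (mulCoeff a b) c n = ∑' k, ∑' i, a i * b (k - i) * c (n - k) := by
    unfold mulCoeff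
    refine tsum_congr fun k => ?_
    rw [tsum_mul_right]
  have hR : mulCoeff a (mulCoeff b c) n = ∑' i, ∑' k, a i * b (k - i) * c (n - k) := by
    unfold mulCoeff
    refine tsum_congr fun i => ?_
    rw [← tsum_mul_left, ← (Equiv.subRight i).tsum_eq]
    refine tsum_congr fun k => ?_
    simp [mul_assoc]
  rw [hL, hR]
  exact Summable.tsum_comm (f := fun i k => a i * b (k - i) * c (n - k)) hS

/-- The bi-infinite series over `ℚ_p` that converge on some annulus `ρ ≤ |z| < 1`
(that is, `0 < v_p(z) ≤ 1/r` with `ρ = p ^ (-1/r)`). -/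
def annulusSeries (p : ℕ) [Fact p.Prime] : Submodule ℚ_[p] (ℤ → ℚ_[p]) where
  carrier := {a | ∃ ρ : ℝ, 0 < ρ ∧ ρ < 1 ∧ ∀ σ, ρ ≤ σ → σ < 1 → ConvergesAt a σ}
  zero_mem' := ⟨1 / 2, by norm_num, by norm_num, fun σ _ _ => by simp [ConvergesAt]⟩
  add_mem' := by
    rintro a b ⟨ρ, h0, h1, h⟩ ⟨ρ', h0', h1', h'⟩
    exact ⟨max ρ ρ', lt_max_of_lt_left h0, max_lt h1 h1', fun σ hσ hσ1 =>
      (h σ ((le_max_left _ _).trans hσ) hσ1).add (h0.trans_le ((le_max_left _ _).trans hσ))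
        (h' σ ((le_max_right _ _).trans hσ) hσ1)⟩
  smul_mem' := by
    rintro r a ⟨ρ, h0, h1, h⟩
    exact ⟨ρ, h0, h1, fun σ hσ hσ1 => (h σ hσ hσ1).smul r⟩

theorem exists_common_radius {p : ℕ} [Fact p.Prime] {a b : ℤ → ℚ_[p]}
    (ha : a ∈ annulusSeries p) (hb : b ∈ annulusSeries p) :
    ∃ ρ : ℝ, 0 < ρ ∧ ρ < 1 ∧ ∀ σ, ρ ≤ σ → σ < 1 → ConvergesAt a σ ∧ ConvergesAt b σ := by
  obtain ⟨ρ, h0, h1, h⟩ := ha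
  obtain ⟨ρ', h0', h1', h'⟩ := hb
  exact ⟨max ρ ρ', lt_max_of_lt_left h0, max_lt h1 h1', fun σ hσ hσ1 =>
      ⟨h σ ((le_max_left _ _).trans hσ) hσ1, h' σ ((le_max_right _ _).trans hσ) hσ1⟩⟩

theorem mulCoeff_mem {p : ℕ} [Fact p.Prime] {a b : ℤ → ℚ_[p]}
    (ha : a ∈ annulusSeries p) (hb : b ∈ annulusSeries p) : mulCoeff a b ∈ annulusSeries p := by
  obtain ⟨ρ, h0, h1, h⟩ := exists_common_radius ha hb
  exact ⟨ρ, h0, h1, fun σ hσ hσ1 => (h σ hσ hσ1).1.mul (h0.trans_le hσ) (h σ hσ hσ1).2⟩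

theorem single_mem {p : ℕ} [Fact p.Prime] (m : ℤ) (r : ℚ_[p]) :
    Pi.single m r ∈ annulusSeries p :=
  ⟨1 / 2, by norm_num, by norm_num, fun σ _ _ => convergesAt_single m r σ⟩

end Robba

/-- The Robba ring over `ℚ_p`: bi-infinite series converging on some annulus `ρ ≤ |z| < 1`. -/
def Robba (p : ℕ) [Fact p.Prime] : Type := ↥(Robba.annulusSeries p)

namespace Robba

noncomputable instance instAddCommGroup (p : ℕ) [Fact p.Prime] : AddCommGroup (Robba p) :=
  inferInstanceAs (AddCommGroup ↥(annulusSeries p))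

noncomputable instance instModule (p : ℕ) [Fact p.Prime] : Module ℚ_[p] (Robba p) :=
  inferInstanceAs (Module ℚ_[p] ↥(annulusSeries p))

/-- The coefficients of an element of the Robba ring. -/
def coeff {p : ℕ} [Fact p.Prime] (f : Robba p) : ℤ → ℚ_[p] := f.1

theorem coeff_mem {p : ℕ} [Fact p.Prime] (f : Robba p) : f.coeff ∈ annulusSeries p := f.2

theorem ext_coeff {p : ℕ} [Fact p.Prime] {f g : Robba p} (h : f.coeff = g.coeff) : f = g :=
  Subtype.ext h

/-- The element of the Robba ring with given coefficients. -/
def ofCoeff {p : ℕ} [Fact p.Prime] (a : ℤ → ℚ_[p]) (ha : a ∈ annulusSeries p) : Robba p := ⟨a, ha⟩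

/-- The monomial `r X ^ m`. -/
noncomputable def monomial {p : ℕ} [Fact p.Prime] (m : ℤ) (r : ℚ_[p]) : Robba p :=
  ofCoeff (Pi.single m r) (single_mem m r)

noncomputable instance instMul (p : ℕ) [Fact p.Prime] : Mul (Robba p) :=
  ⟨fun f g => ofCoeff (mulCoeff f.coeff g.coeff) (mulCoeff_mem f.coeff_mem g.coeff_mem)⟩

noncomputable instance instOne (p : ℕ) [Fact p.Prime] : One (Robba p) := ⟨monomial 0 1⟩

theorem coeff_mul {p : ℕ} [Fact p.Prime] (f g : Robba p) :
    (f * g).coeff = mulCoeff f.coeff g.coeff := rfl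

theorem coeff_one {p : ℕ} [Fact p.Prime] : (1 : Robba p).coeff = Pi.single 0 1 := rfl

theorem coeff_add {p : ℕ} [Fact p.Prime] (f g : Robba p) :
    (f + g).coeff = f.coeff + g.coeff := rfl

theorem coeff_sub {p : ℕ} [Fact p.Prime] (f g : Robba p) :
    (f - g).coeff = f.coeff - g.coeff := rfl

theorem coeff_zero {p : ℕ} [Fact p.Prime] : (0 : Robba p).coeff = 0 := rfl

theorem coeff_smul {p : ℕ} [Fact p.Prime] (r : ℚ_[p]) (f : Robba p) :
    (r • f).coeff = r • f.coeff := rfl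

protected theorem mul_comm' {p : ℕ} [Fact p.Prime] (f g : Robba p) : f * g = g * f :=
  ext_coeff (mulCoeff_comm _ _)

protected theorem one_mul' {p : ℕ} [Fact p.Prime] (f : Robba p) : 1 * f = f := by
  apply ext_coeff
  ext n
  rw [coeff_mul, coeff_one, mulCoeff_single]
  simp

protected theorem mul_assoc' {p : ℕ} [Fact p.Prime] (f g h : Robba p) :
    f * g * h = f * (g * h) := by
  apply ext_coeff
  obtain ⟨ρ, h0, h1, H⟩ := exists_common_radius f.coeff_mem g.coeff_mem
  obtain ⟨ρ', h0', h1', H'⟩ := h.coeff_mem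
  have hm := max_lt h1 h1'
  exact mulCoeff_assoc (lt_max_of_lt_left h0) (H _ (le_max_left _ _) hm).1
    (H _ (le_max_left _ _) hm).2 (H' _ (le_max_right _ _) hm)

protected theorem mul_add' {p : ℕ} [Fact p.Prime] (f g h : Robba p) :
    f * (g + h) = f * g + f * h := by
  apply ext_coeff
  ext n
  obtain ⟨ρ, h0, h1, H⟩ := exists_common_radius f.coeff_mem g.coeff_mem
  obtain ⟨ρ', h0', h1', H'⟩ := exists_common_radius f.coeff_mem h.coeff_mem
  rw [coeff_add, Pi.add_apply]
  simp only [coeff_mul, mulCoeff, coeff_add, Pi.add_apply, mul_add]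
  exact Summable.tsum_add ((H ρ le_rfl h1).1.summable h0 (H ρ le_rfl h1).2 n)
    ((H' ρ' le_rfl h1').1.summable h0' (H' ρ' le_rfl h1').2 n)

protected theorem smul_mul' {p : ℕ} [Fact p.Prime] (r : ℚ_[p]) (f g : Robba p) :
    r • f * g = r • (f * g) := by
  apply ext_coeff
  ext n
  simp only [coeff_mul, coeff_smul, mulCoeff, Pi.smul_apply, smul_eq_mul, mul_assoc, tsum_mul_left]

noncomputable instance instCommRing (p : ℕ) [Fact p.Prime] : CommRing (Robba p) :=
  { instAddCommGroup p, instMul p, instOne p with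
    mul_assoc := Robba.mul_assoc'
    mul_comm := Robba.mul_comm'
    one_mul := Robba.one_mul'
    mul_one := fun f => by rw [Robba.mul_comm', Robba.one_mul']
    left_distrib := Robba.mul_add'
    right_distrib := fun f g h => by
      rw [Robba.mul_comm', Robba.mul_add', Robba.mul_comm' h f, Robba.mul_comm' h g]
    zero_mul := fun f => by
      apply ext_coeff; ext n
      simp [coeff_mul, coeff_zero, mulCoeff]
    mul_zero := fun f => by
      apply ext_coeff; ext n
      simp [coeff_mul, coeff_zero, mulCoeff] }

noncomputable instance instAlgebra (p : ℕ) [Fact p.Prime] : Algebra ℚ_[p] (Robba p) :=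
  Algebra.ofModule Robba.smul_mul' fun r f g => by
    rw [mul_comm, Robba.smul_mul', mul_comm]

end Robba

namespace Robba

/-- The variable `X`. -/
noncomputable def X (p : ℕ) [Fact p.Prime] : Robba p := monomial 1 1

/-- `φ(X) = (1 + X) ^ p - 1`. -/
noncomputable def phiX (p : ℕ) [Fact p.Prime] : Robba p := (1 + X p) ^ p - 1

theorem coeff_X_mul {p : ℕ} [Fact p.Prime] (f : Robba p) (n : ℤ) :
    (X p * f).coeff n = f.coeff (n - 1) := by
  rw [coeff_mul]
  show mulCoeff (Pi.single 1 1) f.coeff n = _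
  rw [mulCoeff_single, one_mul]

theorem X_pow {p : ℕ} [Fact p.Prime] (k : ℕ) : X p ^ k = monomial (k : ℤ) 1 := by
  induction k with
  | zero => rfl
  | succ k ih =>
    rw [pow_succ', ih]
    apply ext_coeff
    ext n
    rw [coeff_X_mul]
    show (Pi.single (k : ℤ) 1 : ℤ → ℚ_[p]) (n - 1) = (Pi.single ((k + 1 : ℕ) : ℤ) 1 : ℤ → ℚ_[p]) n
    simp only [Pi.single_apply]
    congr 1
    push_cast
    exact propext ⟨fun h => by omega, fun h => by omega⟩

theorem coeff_aeval {p : ℕ} [Fact p.Prime] (q : Polynomial ℚ_[p]) (n : ℤ) :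
    (Polynomial.aeval (X p) q).coeff n = if 0 ≤ n then q.coeff n.toNat else 0 := by
  induction q using Polynomial.induction_on' with
  | add f g hf hg =>
    rw [map_add, coeff_add, Pi.add_apply, hf, hg]
    split_ifs <;> simp
  | monomial m r =>
    rw [Polynomial.aeval_monomial, X_pow, ← Algebra.smul_def, coeff_smul, Pi.smul_apply]
    show r • (Pi.single (m : ℤ) 1 : ℤ → ℚ_[p]) n = _
    simp only [Pi.single_apply, Polynomial.coeff_monomial, smul_eq_mul]
    split_ifs <;> first | omega | simp

/-- `(1 + X) ^ p - 1` as a polynomial. -/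
noncomputable def phiPoly (p : ℕ) [Fact p.Prime] : Polynomial ℚ_[p] :=
  (1 + Polynomial.X) ^ p - 1

theorem aeval_phiPoly (p : ℕ) [Fact p.Prime] : Polynomial.aeval (X p) (phiPoly p) = phiX p := by
  simp [phiPoly, phiX]

theorem coeff_phiPoly (p : ℕ) [Fact p.Prime] (k : ℕ) :
    (phiPoly p).coeff k = if k = 0 then 0 else (p.choose k : ℚ_[p]) := by
  rw [phiPoly, Polynomial.coeff_sub, Polynomial.coeff_one_add_X_pow, Polynomial.coeff_one]
  split_ifs <;> simp_all

/-- The power series `((1 + Y) ^ p - Y ^ p)⁻¹`. With `Y = 1 / X` it is `X ^ p / φ(X)`. -/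
noncomputable def invSeries (p : ℕ) [Fact p.Prime] : PowerSeries ℚ_[p] :=
  ((1 + PowerSeries.X) ^ p - PowerSeries.X ^ p)⁻¹

theorem coeff_one_add_pow_sub (p : ℕ) [Fact p.Prime] (k : ℕ) :
    PowerSeries.coeff k ((1 + PowerSeries.X) ^ p - PowerSeries.X ^ p : PowerSeries ℚ_[p]) =
      if k < p then (p.choose k : ℚ_[p]) else 0 := by
  have h : ((1 + PowerSeries.X) ^ p - PowerSeries.X ^ p : PowerSeries ℚ_[p]) =
      (((1 + Polynomial.X) ^ p - Polynomial.X ^ p : Polynomial ℚ_[p]) : PowerSeries ℚ_[p]) := by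
    simp
  rw [h, Polynomial.coeff_coe, Polynomial.coeff_sub, Polynomial.coeff_one_add_X_pow,
    Polynomial.coeff_X_pow]
  rcases lt_trichotomy k p with h1 | h1 | h1
  · rw [if_neg h1.ne, if_pos h1, sub_zero]
  · subst h1; simp
  · rw [if_neg h1.ne', if_neg h1.not_gt, Nat.choose_eq_zero_of_lt h1]; simp

theorem mul_invSeries (p : ℕ) [Fact p.Prime] :
    ((1 + PowerSeries.X) ^ p - PowerSeries.X ^ p) * invSeries p = 1 := by
  apply PowerSeries.mul_inv_cancel
  have := (Fact.out : p.Prime).ne_zero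
  simp [this]

theorem norm_choose_le {p : ℕ} [hp : Fact p.Prime] {k : ℕ} (h0 : k ≠ 0) (h1 : k < p) :
    ‖(p.choose k : ℚ_[p])‖ ≤ (p : ℝ)⁻¹ := by
  obtain ⟨c, hc⟩ := hp.out.dvd_choose_self h0 h1
  rw [hc, Nat.cast_mul, norm_mul, Padic.norm_p]
  have : ‖(c : ℚ_[p])‖ ≤ 1 := by simpa using Padic.norm_int_le_one (p := p) (c : ℤ)
  exact mul_le_of_le_one_right (by positivity) this

theorem norm_invSeries_le {p : ℕ} [hp : Fact p.Prime] {σ : ℝ} (h0 : 0 < σ) (h1 : σ < 1)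
    (h : (p : ℝ)⁻¹ ≤ σ ^ p) (m : ℕ) : ‖PowerSeries.coeff m (invSeries p)‖ ≤ σ ^ m := by
  induction m using Nat.strong_induction_on with
  | _ m ih =>
    have key := congrArg (PowerSeries.coeff m) (mul_invSeries p)
    rw [PowerSeries.coeff_mul, PowerSeries.coeff_one] at key
    have hpp := hp.out.pos
    have h00 : (0, m) ∈ Finset.HasAntidiagonal.antidiagonal m := by simp
    rw [← Finset.add_sum_erase _ _ h00, coeff_one_add_pow_sub, if_pos hpp, Nat.choose_zero_right,
      Nat.cast_one, one_mul] at key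
    rw [eq_sub_of_add_eq key]
    by_cases hm : m = 0
    · subst hm
      simp
    rw [if_neg hm, zero_sub, norm_neg]
    apply IsUltrametricDist.norm_sum_le_of_forall_le_of_nonneg (by positivity)
    rintro ⟨i, j⟩ hij
    simp only [Finset.mem_erase, Finset.HasAntidiagonal.mem_antidiagonal, ne_eq, Prod.mk.injEq] at hij
    obtain ⟨hne, hij⟩ := hij
    have hi : i ≠ 0 := fun hi => hne ⟨hi, by omega⟩
    simp only [coeff_one_add_pow_sub]
    split_ifs with hip
    · rw [norm_mul]
      calc _ ≤ σ ^ i * σ ^ j := by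
            apply mul_le_mul _ (ih j (by omega)) (norm_nonneg _) (by positivity)
            exact (norm_choose_le hi hip).trans (h.trans (pow_le_pow_of_le_one h0.le h1.le hip.le))
        _ = σ ^ m := by rw [← pow_add, hij]
    · simp; positivity

/-- Coefficients of `φ(X)⁻¹`. -/
noncomputable def invCoeff (p : ℕ) [Fact p.Prime] (n : ℤ) : ℚ_[p] :=
  if n ≤ -p then PowerSeries.coeff (-p - n).toNat (invSeries p) else 0

theorem norm_invCoeff_le {p : ℕ} [hp : Fact p.Prime] {σ : ℝ} (h0 : 0 < σ) (h1 : σ < 1)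
    (h : (p : ℝ)⁻¹ ≤ σ ^ p) (n : ℤ) : ‖invCoeff p n‖ * σ ^ n ≤ (σ ^ p)⁻¹ := by
  unfold invCoeff
  split_ifs with hn
  · calc _ ≤ σ ^ (-p - n).toNat * σ ^ n :=
          mul_le_mul_of_nonneg_right (norm_invSeries_le h0 h1 h _) (by positivity)
      _ = (σ ^ p)⁻¹ := by
          rw [← zpow_natCast, Int.toNat_of_nonneg (by omega), ← zpow_add₀ h0.ne',
            ← zpow_natCast, ← zpow_neg]
          congr 1; ring
  · simp; positivity

theorem convergesAt_invCoeff {p : ℕ} [hp : Fact p.Prime] {ρ σ : ℝ} (h0 : 0 < ρ) (h1 : ρ < 1)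
    (h : (p : ℝ)⁻¹ ≤ ρ ^ p) (hρ : ρ < σ) : ConvergesAt (invCoeff p) σ := by
  unfold ConvergesAt
  rw [Int.cofinite_eq, tendsto_sup]
  have hσ := h0.trans hρ
  constructor
  · have hb : ∀ n : ℤ, ‖invCoeff p n‖ * σ ^ n ≤ (ρ ^ p)⁻¹ * (ρ / σ) ^ (-n) := by
      intro n
      have h2 := norm_invCoeff_le h0 h1 h n
      calc _ = (‖invCoeff p n‖ * ρ ^ n) * (ρ / σ) ^ (-n) := by
            rw [zpow_neg, div_zpow]
            have := (zpow_pos h0 n).ne'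
            have := (zpow_pos hσ n).ne'
            field_simp
        _ ≤ _ := mul_le_mul_of_nonneg_right h2 (by positivity)
    refine squeeze_zero (fun n => by positivity) hb ?_
    rw [← mul_zero ((ρ ^ p)⁻¹)]
    apply Tendsto.const_mul
    have h3 : Tendsto (fun n : ℕ => (ρ / σ) ^ n) atTop (𝓝 0) :=
      tendsto_pow_atTop_nhds_zero_of_lt_one (by positivity) ((div_lt_one hσ).2 hρ)
    have h4 : Tendsto (fun n : ℤ => (-n).toNat) atBot atTop := by
      refine tendsto_atTop.2 fun N => ?_
      filter_upwards [eventually_le_atBot (-N : ℤ)] with n hn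
      omega
    refine (h3.comp h4).congr' ?_
    filter_upwards [eventually_le_atBot (0 : ℤ)] with n hn
    simp only [Function.comp]
    rw [← zpow_natCast, Int.toNat_of_nonneg (by omega)]
  · apply tendsto_const_nhds.congr'
    filter_upwards [eventually_ge_atTop (0 : ℤ)] with n hn
    have := hp.out.pos
    rw [invCoeff, if_neg (by omega)]
    simp

theorem exists_radius (p : ℕ) [hp : Fact p.Prime] :
    ∃ ρ : ℝ, 0 < ρ ∧ ρ < 1 ∧ (p : ℝ)⁻¹ ≤ ρ ^ p := by
  have hlt : (p : ℝ)⁻¹ < 1 := inv_lt_one_of_one_lt₀ (by exact_mod_cast hp.out.one_lt)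
  have hc : Tendsto (fun x : ℝ => x ^ p) (𝓝[<] 1) (𝓝 1) := by
    have : Tendsto (fun x : ℝ => x ^ p) (𝓝 1) (𝓝 (1 ^ p)) := (continuous_pow p).tendsto 1
    rw [one_pow] at this
    exact this.mono_left nhdsWithin_le_nhds
  have h1 : ∀ᶠ x : ℝ in 𝓝[<] 1, 0 < x :=
    nhdsWithin_le_nhds (lt_mem_nhds (zero_lt_one))
  obtain ⟨x, hx, hx0, hx1⟩ := ((hc.eventually (lt_mem_nhds hlt)).and
    (h1.and self_mem_nhdsWithin)).exists
  exact ⟨x, hx0, hx1, hx.le⟩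

theorem invCoeff_mem (p : ℕ) [Fact p.Prime] : invCoeff p ∈ annulusSeries p := by
  obtain ⟨ρ, h0, h1, h⟩ := exists_radius p
  exact ⟨(ρ + 1) / 2, by linarith, by linarith, fun σ hσ _ =>
    convergesAt_invCoeff h0 h1 h (by linarith)⟩

/-- `φ(X)⁻¹`. -/
noncomputable def phiXInv (p : ℕ) [Fact p.Prime] : Robba p :=
  ofCoeff (invCoeff p) (invCoeff_mem p)

theorem coeff_phiX (p : ℕ) [Fact p.Prime] (n : ℤ) :
    (phiX p).coeff n = if 0 < n then (p.choose n.toNat : ℚ_[p]) else 0 := by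
  rw [← aeval_phiPoly, coeff_aeval, coeff_phiPoly]
  split_ifs <;> first | omega | rfl

theorem phiX_mul_inv (p : ℕ) [hp : Fact p.Prime] : phiX p * phiXInv p = 1 := by
  apply ext_coeff
  ext n
  rw [coeff_mul, coeff_one]
  show mulCoeff (phiX p).coeff (invCoeff p) n = _
  have hinj : Function.Injective (fun i : ℕ => (p : ℤ) - i) := fun i j h => by
    simpa using h
  unfold mulCoeff
  rw [← hinj.tsum_eq]
  swap
  · intro k hk
    rw [Function.mem_support] at hk
    have hk' : k ≤ p := by
      by_contra hlt
      apply hk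
      rw [coeff_phiX, if_pos (by omega), Nat.choose_eq_zero_of_lt (by omega)]
      simp
    exact ⟨(p - k).toNat, by simp only; omega⟩
  have hterm : ∀ i : ℕ, (phiX p).coeff ((p : ℤ) - i) * invCoeff p (n - ((p : ℤ) - i)) =
      if (i : ℤ) ≤ -n then PowerSeries.coeff i
        ((1 + PowerSeries.X) ^ p - PowerSeries.X ^ p : PowerSeries ℚ_[p]) *
        PowerSeries.coeff (-n - i).toNat (invSeries p) else 0 := by
    intro i
    rw [coeff_phiX, coeff_one_add_pow_sub]
    by_cases hi : i < p
    · have e1 : ((p : ℤ) - i).toNat = p - i := by omega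
      rw [if_pos (by omega), if_pos hi, e1, Nat.choose_symm hi.le, invCoeff]
      have e2 : (-(p : ℤ) - (n - (p - i))).toNat = (-n - i).toNat := by
        congr 1; ring
      rw [e2]
      split_ifs <;> first | omega | simp
    · rw [if_neg (by omega), if_neg hi]
      simp
  simp only [hterm]
  by_cases hn : n ≤ 0
  · obtain ⟨m, rfl⟩ : ∃ m : ℕ, n = -m := ⟨(-n).toNat, by omega⟩
    rw [tsum_eq_sum (s := Finset.range (m + 1))]
    · have key := congrArg (PowerSeries.coeff m) (mul_invSeries p)
      rw [PowerSeries.coeff_mul, Finset.Nat.sum_antidiagonal_eq_sum_range_succ_mk] at key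
      have : (Pi.single 0 1 : ℤ → ℚ_[p]) (-m) = PowerSeries.coeff m (1 : PowerSeries ℚ_[p]) := by
        rw [PowerSeries.coeff_one, Pi.single_apply]
        congr 1
        simp
      rw [this, ← key]
      refine Finset.sum_congr rfl fun i hi => ?_
      rw [Finset.mem_range] at hi
      have e : (- -(m : ℤ) - i).toNat = m - i := by omega
      rw [if_pos (by omega), e]
    · intro i hi
      rw [Finset.mem_range] at hi
      rw [if_neg (by omega)]
  · rw [Pi.single_eq_of_ne (by omega)]
    convert tsum_zero with i
    rw [if_neg (by omega)]

/-- `φ(X)` as a unit of the Robba ring. -/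
noncomputable def phiUnit (p : ℕ) [Fact p.Prime] : (Robba p)ˣ where
  val := phiX p
  inv := phiXInv p
  val_inv := phiX_mul_inv p
  inv_val := by rw [mul_comm]; exact phiX_mul_inv p

/-- The coefficient of `X ^ n` in `φ(X) ^ k`. -/
noncomputable def phiCoeff {p : ℕ} [Fact p.Prime] (k n : ℤ) : ℚ_[p] :=
  ((phiUnit p ^ k : (Robba p)ˣ) : Robba p).coeff n

end Robba

namespace Robba

theorem mem_annulusSeries_iff {p : ℕ} [Fact p.Prime] {a : ℤ → ℚ_[p]} :
    a ∈ annulusSeries p ↔ ∀ᶠ σ in 𝓝[<] (1 : ℝ), ConvergesAt a σ := by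
  constructor
  · rintro ⟨ρ, h0, h1, h⟩
    filter_upwards [Ioo_mem_nhdsLT h1] with σ hσ
    exact h σ hσ.1.le hσ.2
  · intro h
    have h2 : ∀ᶠ σ in 𝓝[<] (1 : ℝ), 0 < σ := nhdsWithin_le_nhds (lt_mem_nhds zero_lt_one)
    obtain ⟨l, hl, hs⟩ := (mem_nhdsLT_iff_exists_Ioo_subset).1 (h.and h2)
    have hl' : l < 1 := hl
    have hρ : (l + 1) / 2 ∈ Set.Ioo l 1 := ⟨by linarith, by linarith⟩
    exact ⟨(l + 1) / 2, (hs hρ).2, hρ.2, fun σ hσ hσ1 => (hs ⟨hρ.1.trans_le hσ, hσ1⟩).1⟩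

theorem tendsto_pow_left {p : ℕ} (hp : p ≠ 0) :
    Tendsto (fun x : ℝ => x ^ p) (𝓝[<] 1) (𝓝[<] 1) := by
  apply tendsto_nhdsWithin_of_tendsto_nhds_of_eventually_within
  · have : Tendsto (fun x : ℝ => x ^ p) (𝓝 1) (𝓝 (1 ^ p)) := (continuous_pow p).tendsto 1
    rw [one_pow] at this
    exact this.mono_left nhdsWithin_le_nhds
  · filter_upwards [Ioo_mem_nhdsLT (zero_lt_one (α := ℝ))] with x hx
    exact pow_lt_one₀ hx.1.le hx.2 hp

/-- Radii at which the powers of `φ(X)` behave like those of `X ^ p`. -/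
structure GoodRadius (p : ℕ) [Fact p.Prime] (σ : ℝ) : Prop where
  pos : 0 < σ
  conv : ∀ k, ConvergesAt (phiCoeff (p := p) k) σ
  bound : ∀ k n, ‖phiCoeff (p := p) k n‖ * σ ^ n ≤ (σ ^ p) ^ k

theorem phiCoeff_add {p : ℕ} [Fact p.Prime] (k m : ℤ) :
    phiCoeff (p := p) (k + m) = mulCoeff (phiCoeff k) (phiCoeff m) := by
  ext n
  unfold phiCoeff
  rw [zpow_add, Units.val_mul, coeff_mul]

theorem phiCoeff_zero {p : ℕ} [Fact p.Prime] : phiCoeff (p := p) 0 = Pi.single 0 1 := by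
  ext n
  unfold phiCoeff
  rw [zpow_zero]
  rfl

theorem bound_mul {p : ℕ} [Fact p.Prime] {a b : ℤ → ℚ_[p]} {σ A B : ℝ} (hσ : 0 < σ)
    (hA : 0 ≤ A) (hB : 0 ≤ B) (ha : ∀ n, ‖a n‖ * σ ^ n ≤ A) (hb : ∀ n, ‖b n‖ * σ ^ n ≤ B)
    (n : ℤ) : ‖mulCoeff a b n‖ * σ ^ n ≤ A * B := by
  have hp : 0 < σ ^ n := zpow_pos hσ n
  rw [← le_div_iff₀ hp]
  apply IsUltrametricDist.norm_tsum_le_of_forall_le_of_nonneg (by positivity)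
  intro k
  rw [le_div_iff₀ hp, norm_mul]
  have : σ ^ n = σ ^ k * σ ^ (n - k) := by rw [← zpow_add₀ hσ.ne']; congr 1; ring
  calc _ = (‖a k‖ * σ ^ k) * (‖b (n - k)‖ * σ ^ (n - k)) := by rw [this]; ring
    _ ≤ A * B := mul_le_mul (ha k) (hb _) (by positivity) hA

theorem norm_coeff_phiX_le {p : ℕ} [hp : Fact p.Prime] {σ : ℝ} (h0 : 0 < σ) (h1 : σ < 1)
    (h : (p : ℝ)⁻¹ ≤ σ ^ p) (n : ℤ) : ‖(phiX p).coeff n‖ * σ ^ n ≤ σ ^ p := by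
  rw [coeff_phiX]
  split_ifs with hn
  · obtain ⟨m, rfl⟩ : ∃ m : ℕ, n = m := ⟨n.toNat, by omega⟩
    rw [Int.toNat_natCast, zpow_natCast]
    rcases lt_trichotomy m p with hm | hm | hm
    · calc _ ≤ (p : ℝ)⁻¹ * 1 := mul_le_mul (norm_choose_le (by omega) hm)
            (pow_le_one₀ h0.le h1.le) (by positivity) (by positivity)
        _ ≤ _ := by simpa using h
    · subst hm; simp
    · rw [Nat.choose_eq_zero_of_lt hm]; simp; positivity
  · simp; positivity

theorem convergesAt_aeval {p : ℕ} [Fact p.Prime] (q : Polynomial ℚ_[p]) (σ : ℝ) :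
    ConvergesAt (Polynomial.aeval (X p) q).coeff σ := by
  apply tendsto_const_nhds.congr'
  rw [EventuallyEq, eventually_cofinite]
  refine (Set.finite_Icc (0 : ℤ) q.natDegree).subset fun n hn => ?_
  by_contra h
  apply hn
  rw [coeff_aeval]
  split_ifs with h0
  · rw [Polynomial.coeff_eq_zero_of_natDegree_lt]
    · simp
    · simp only [Set.mem_Icc, not_and, not_le] at h
      have := h h0
      omega
  · simp

theorem goodRadius_of {p : ℕ} [hp : Fact p.Prime] {ρ σ : ℝ} (h0 : 0 < ρ) (h1 : σ < 1)
    (h : (p : ℝ)⁻¹ ≤ ρ ^ p) (hρ : ρ < σ) : GoodRadius p σ := by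
  have hσ := h0.trans hρ
  have h' : (p : ℝ)⁻¹ ≤ σ ^ p := h.trans (pow_le_pow_left₀ h0.le hρ.le p)
  have main : ∀ k, ConvergesAt (phiCoeff (p := p) k) σ ∧
      ∀ n, ‖phiCoeff (p := p) k n‖ * σ ^ n ≤ (σ ^ p) ^ k := by
    have e1 : phiCoeff (p := p) 1 = (phiX p).coeff := by
      ext n; unfold phiCoeff; rw [zpow_one]; rfl
    have e2 : phiCoeff (p := p) (-1) = invCoeff p := by
      ext n; unfold phiCoeff; rw [zpow_neg_one]; rfl
    intro k
    induction k using Int.induction_on with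
    | zero =>
      rw [phiCoeff_zero]
      refine ⟨convergesAt_single _ _ _, fun n => ?_⟩
      rw [Pi.single_apply]
      split_ifs with hn <;> simp [hn]
    | succ k ih =>
      rw [phiCoeff_add, zpow_add₀ (pow_pos hσ p).ne', e1, zpow_one]
      refine ⟨ih.1.mul hσ ?_, bound_mul hσ (by positivity) (by positivity) ih.2
        (norm_coeff_phiX_le hσ h1 h')⟩
      rw [← aeval_phiPoly]
      exact convergesAt_aeval _ _
    | pred k ih =>
      rw [sub_eq_add_neg, phiCoeff_add, zpow_add₀ (pow_pos hσ p).ne', e2, zpow_neg_one]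
      exact ⟨ih.1.mul hσ (convergesAt_invCoeff h0 (hρ.trans h1) h hρ),
        bound_mul hσ (by positivity) (by positivity) ih.2 (norm_invCoeff_le hσ h1 h')⟩
  exact ⟨hσ, fun k => (main k).1, fun k => (main k).2⟩

theorem eventually_goodRadius (p : ℕ) [hp : Fact p.Prime] :
    ∀ᶠ σ in 𝓝[<] (1 : ℝ), GoodRadius p σ := by
  obtain ⟨ρ, h0, h1, h⟩ := exists_radius p
  filter_upwards [Ioo_mem_nhdsLT h1] with σ hσ
  exact goodRadius_of h0 hσ.2 h hσ.1

/-- Coefficients of `f(φ(X)) = ∑ aₖ φ(X) ^ k`. -/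
noncomputable def phiRaw {p : ℕ} [Fact p.Prime] (a : ℤ → ℚ_[p]) (n : ℤ) : ℚ_[p] :=
  ∑' k : ℤ, a k * phiCoeff k n

theorem tendsto_phi_weight {p : ℕ} [Fact p.Prime] {a : ℤ → ℚ_[p]} {σ : ℝ} (hσ : GoodRadius p σ)
    (ha : ConvergesAt a (σ ^ p)) :
    Tendsto (fun x : ℤ × ℤ => ‖a x.2 * phiCoeff x.2 x.1‖ * σ ^ x.1) cofinite (𝓝 0) := by
  have h0 := hσ.pos
  rw [Metric.tendsto_nhds]
  intro ε hε
  have h1 := (Metric.tendsto_nhds.1 ha) ε hε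
  rw [eventually_cofinite] at h1 ⊢
  have h2 : ∀ k : ℤ, {n : ℤ | ¬ dist (‖a k * phiCoeff k n‖ * σ ^ n) 0 < ε}.Finite := by
    intro k
    exact eventually_cofinite.1 (Metric.tendsto_nhds.1 ((hσ.conv k).smul (a k)) ε hε)
  refine (h1.biUnion fun k _ => (h2 k).image fun n => (n, k)).subset ?_
  rintro ⟨n, k⟩ hnk
  rw [Set.mem_iUnion₂]
  refine ⟨k, ?_, n, hnk, rfl⟩
  intro hlt
  apply hnk
  rw [dist_zero_right, Real.norm_of_nonneg (by positivity)] at hlt ⊢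
  refine lt_of_le_of_lt ?_ hlt
  simp only [norm_mul, mul_assoc]
  exact mul_le_mul_of_nonneg_left (hσ.bound k n) (norm_nonneg _)

theorem eventually_phi {p : ℕ} [hp : Fact p.Prime] {a : ℤ → ℚ_[p]} (ha : a ∈ annulusSeries p) :
    ∀ᶠ σ in 𝓝[<] (1 : ℝ), GoodRadius p σ ∧ ConvergesAt a (σ ^ p) :=
  (eventually_goodRadius p).and
    ((tendsto_pow_left hp.out.ne_zero).eventually (mem_annulusSeries_iff.1 ha))

theorem phiRaw_mem {p : ℕ} [hp : Fact p.Prime] {a : ℤ → ℚ_[p]} (ha : a ∈ annulusSeries p) :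
    phiRaw a ∈ annulusSeries p := by
  rw [mem_annulusSeries_iff]
  filter_upwards [eventually_phi ha] with σ hσ
  exact convergesAt_tsum (F := fun n k => a k * phiCoeff k n) hσ.1.pos
    (tendsto_phi_weight hσ.1 hσ.2)

theorem phi_summable {p : ℕ} [hp : Fact p.Prime] {a : ℤ → ℚ_[p]} (ha : a ∈ annulusSeries p)
    (n : ℤ) : Summable fun k => a k * phiCoeff k n := by
  obtain ⟨σ, hσ, h⟩ := (eventually_phi ha).exists
  refine summable_of_weight (σ ^ n)⁻¹
    ((tendsto_phi_weight hσ h).comp (Prod.mk_right_injective n).tendsto_cofinite) ?_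
  intro k
  have hp : 0 < σ ^ n := zpow_pos hσ.pos n
  simp only [Function.comp]
  field_simp
  exact le_rfl

theorem phiRaw_mul {p : ℕ} [hp : Fact p.Prime] {a b : ℤ → ℚ_[p]} (ha : a ∈ annulusSeries p)
    (hb : b ∈ annulusSeries p) : phiRaw (mulCoeff a b) = mulCoeff (phiRaw a) (phiRaw b) := by
  ext n
  obtain ⟨σ, ⟨hσ, hca⟩, ⟨-, hcb⟩⟩ := ((eventually_phi ha).and (eventually_phi hb)).exists
  have h0 := hσ.pos
  have hpn : 0 < σ ^ n := zpow_pos h0 n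
  have hS : Summable (fun x : ℤ × (ℤ × ℤ) =>
      (a x.2.1 * phiCoeff x.2.1 x.1) * (b x.2.2 * phiCoeff x.2.2 (n - x.1))) := by
    have h := tendsto_mul_cofinite_nhds_zero (tendsto_phi_weight hσ hca)
      (tendsto_phi_weight hσ hcb)
    have hinj : Function.Injective
        (fun x : ℤ × (ℤ × ℤ) => (((x.1, x.2.1), (n - x.1, x.2.2)) : (ℤ × ℤ) × (ℤ × ℤ))) := by
      rintro ⟨x1, x2, x3⟩ ⟨y1, y2, y3⟩ hxy
      simp only [Prod.mk.injEq] at hxy ⊢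
      omega
    refine summable_of_weight (σ ^ n)⁻¹ (h.comp hinj.tendsto_cofinite) ?_
    rintro ⟨l, k, m⟩
    simp only [Function.comp]
    have : σ ^ n = σ ^ l * σ ^ (n - l) := by rw [← zpow_add₀ h0.ne']; congr 1; ring
    rw [le_inv_mul_iff₀ hpn, this, norm_mul]
    apply le_of_eq; ring
  have hS' : Summable (fun x : (ℤ × ℤ) × ℤ =>
      (a x.1.1 * phiCoeff x.1.1 x.2) * (b x.1.2 * phiCoeff x.1.2 (n - x.2))) :=
    ((Equiv.prodComm (ℤ × ℤ) ℤ).summable_iff.2 hS)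
  have : NonarchimedeanRing ℚ_[p] := ⟨NonarchimedeanAddGroup.is_nonarchimedean⟩
  have hR : mulCoeff (phiRaw a) (phiRaw b) n = ∑' (l : ℤ) (x : ℤ × ℤ),
      (a x.1 * phiCoeff x.1 l) * (b x.2 * phiCoeff x.2 (n - l)) := by
    unfold mulCoeff
    refine tsum_congr fun l => ?_
    exact tsum_mul_tsum_of_nonarchimedean (phi_summable ha l) (phi_summable hb (n - l))
  have hR2 : ∑' (l : ℤ) (x : ℤ × ℤ), (a x.1 * phiCoeff x.1 l) * (b x.2 * phiCoeff x.2 (n - l)) =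
      ∑' (x : ℤ × ℤ), a x.1 * b x.2 * phiCoeff (x.1 + x.2) n := by
    rw [← Summable.tsum_comm (f := fun (l : ℤ) (x : ℤ × ℤ) =>
      (a x.1 * phiCoeff x.1 l) * (b x.2 * phiCoeff x.2 (n - l))) hS]
    refine tsum_congr fun x => ?_
    rw [phiCoeff_add]
    unfold mulCoeff
    rw [← tsum_mul_left]
    exact tsum_congr fun l => by ring
  have hS2 : Summable (fun x : ℤ × ℤ => a x.1 * b x.2 * phiCoeff (x.1 + x.2) n) := by
    refine hS'.prod.congr fun x => ?_
    rw [phiCoeff_add]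
    unfold mulCoeff
    rw [← tsum_mul_left]
    exact tsum_congr fun l => by ring
  let e : ℤ × ℤ ≃ ℤ × ℤ :=
    { toFun := fun x => (x.2, x.1 - x.2)
      invFun := fun x => (x.1 + x.2, x.1)
      left_inv := fun x => by ext <;> simp
      right_inv := fun x => by ext <;> simp }
  have hS3 : Summable (fun x : ℤ × ℤ => a x.2 * b (x.1 - x.2) * phiCoeff x.1 n) := by
    refine (e.summable_iff.2 hS2).congr fun x => ?_
    simp [e]
  rw [hR, hR2, ← e.tsum_eq]
  have : ∀ x : ℤ × ℤ, a (e x).1 * b (e x).2 * phiCoeff ((e x).1 + (e x).2) n =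
      a x.2 * b (x.1 - x.2) * phiCoeff x.1 n := by
    intro x; simp [e]
  simp only [this]
  rw [hS3.tsum_prod]
  unfold phiRaw mulCoeff
  refine tsum_congr fun j => ?_
  exact tsum_mul_right.symm

/-- The Frobenius `φ(f)(X) = f((1 + X) ^ p - 1)` of the Robba ring. -/
noncomputable def phi (p : ℕ) [Fact p.Prime] : Robba p →ₐ[ℚ_[p]] Robba p :=
  AlgHom.ofLinearMap
    { toFun := fun f => ofCoeff (phiRaw f.coeff) (phiRaw_mem f.coeff_mem)
      map_add' := fun f g => by
        apply ext_coeff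
        ext n
        show phiRaw (f.coeff + g.coeff) n = phiRaw f.coeff n + phiRaw g.coeff n
        simp only [phiRaw, Pi.add_apply, add_mul]
        exact Summable.tsum_add (phi_summable f.coeff_mem n) (phi_summable g.coeff_mem n)
      map_smul' := fun r f => by
        apply ext_coeff
        ext n
        show phiRaw (r • f.coeff) n = r • phiRaw f.coeff n
        simp only [phiRaw, Pi.smul_apply, smul_eq_mul, mul_assoc, tsum_mul_left] }
    (by
      apply ext_coeff
      ext n
      show phiRaw (Pi.single 0 1) n = (Pi.single 0 1 : ℤ → ℚ_[p]) n
      unfold phiRaw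
      rw [tsum_eq_single 0, phiCoeff_zero]
      · simp
      · intro k hk
        simp [Pi.single_eq_of_ne hk])
    (fun f g => by
      apply ext_coeff
      exact phiRaw_mul f.coeff_mem g.coeff_mem)

theorem coeff_phi {p : ℕ} [Fact p.Prime] (f : Robba p) (n : ℤ) :
    (phi p f).coeff n = ∑' k : ℤ, f.coeff k * phiCoeff k n := rfl

end Robba

namespace Robba

theorem phi_X (p : ℕ) [Fact p.Prime] : phi p (X p) = (1 + X p) ^ p - 1 := by
  apply ext_coeff
  ext n
  rw [coeff_phi, tsum_eq_single 1]
  · show (Pi.single 1 1 : ℤ → ℚ_[p]) 1 * phiCoeff 1 n = _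
    rw [Pi.single_eq_same, one_mul, phiCoeff, zpow_one]
    rfl
  · intro k hk
    show (Pi.single 1 1 : ℤ → ℚ_[p]) k * phiCoeff k n = 0
    rw [Pi.single_eq_of_ne hk, zero_mul]

theorem ConvergesAt.mono_of_neg {p : ℕ} [Fact p.Prime] {a : ℤ → ℚ_[p]} {σ τ : ℝ}
    (h : ConvergesAt a τ) (ha : ∀ n < 0, a n = 0) (h0 : 0 < σ) (hle : σ ≤ τ) :
    ConvergesAt a σ := by
  refine squeeze_zero (fun n => by positivity) (fun n => ?_) h
  rcases lt_or_ge n 0 with hn | hn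
  · simp [ha n hn]
  · exact mul_le_mul_of_nonneg_left (zpow_le_zpow_left₀ hn h0.le hle) (norm_nonneg _)

theorem convergesAt_of_neg {p : ℕ} [Fact p.Prime] {a : ℤ → ℚ_[p]} (hm : a ∈ annulusSeries p)
    (ha : ∀ n < 0, a n = 0) (σ : ℝ) (h0 : 0 < σ) (h1 : σ < 1) : ConvergesAt a σ := by
  obtain ⟨ρ, hρ0, hρ1, h⟩ := hm
  exact (h (max ρ σ) (le_max_left _ _) (max_lt hρ1 h1)).mono_of_neg ha h0 (le_max_right _ _)

/-- The ring `R⁺` of power series `∑_{n ≥ 0} aₙ X ^ n` over `ℚ_p` that converge on the open unit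
disk. -/
noncomputable def plus (p : ℕ) [Fact p.Prime] : Subalgebra ℚ_[p] (Robba p) where
  carrier := {f | (∀ n < 0, f.coeff n = 0) ∧ ∀ σ : ℝ, 0 < σ → σ < 1 → ConvergesAt f.coeff σ}
  mul_mem' := by
    rintro f g ⟨hf, hf'⟩ ⟨hg, hg'⟩
    refine ⟨fun n hn => ?_, fun σ h0 h1 => (hf' σ h0 h1).mul h0 (hg' σ h0 h1)⟩
    rw [coeff_mul]
    unfold mulCoeff
    convert tsum_zero with k
    rcases lt_or_ge k 0 with hk | hk
    · rw [hf k hk, zero_mul]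
    · rw [hg (n - k) (by omega), mul_zero]
  add_mem' := by
    rintro f g ⟨hf, hf'⟩ ⟨hg, hg'⟩
    refine ⟨fun n hn => ?_, fun σ h0 h1 => (hf' σ h0 h1).add h0 (hg' σ h0 h1)⟩
    rw [coeff_add, Pi.add_apply, hf n hn, hg n hn, add_zero]
  algebraMap_mem' := by
    intro r
    have h : (algebraMap ℚ_[p] (Robba p) r).coeff = r • Pi.single 0 1 := by
      rw [Algebra.algebraMap_eq_smul_one, coeff_smul, coeff_one]
    refine ⟨fun n hn => ?_, fun σ _ _ => ?_⟩
    · rw [h]; simp [Pi.single_eq_of_ne hn.ne]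
    · rw [h]; exact (convergesAt_single 0 1 σ).smul r

theorem mem_plus_of_neg {p : ℕ} [Fact p.Prime] {f : Robba p} (h : ∀ n < 0, f.coeff n = 0) :
    f ∈ plus p := ⟨h, convergesAt_of_neg f.coeff_mem h⟩

theorem phiCoeff_natCast {p : ℕ} [Fact p.Prime] (k : ℕ) (n : ℤ) :
    phiCoeff (p := p) k n = if 0 ≤ n then (phiPoly p ^ k).coeff n.toNat else 0 := by
  unfold phiCoeff
  rw [← coeff_aeval, map_pow, aeval_phiPoly, zpow_natCast, Units.val_pow_eq_pow_val]
  rfl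

theorem phi_mem_plus {p : ℕ} [Fact p.Prime] {f : Robba p} (hf : f ∈ plus p) :
    phi p f ∈ plus p := by
  apply mem_plus_of_neg
  intro n hn
  rw [coeff_phi]
  convert tsum_zero with k
  rcases lt_or_ge k 0 with hk | hk
  · rw [hf.1 k hk, zero_mul]
  · obtain ⟨m, rfl⟩ : ∃ m : ℕ, k = m := ⟨k.toNat, by omega⟩
    rw [phiCoeff_natCast, if_neg (by omega), mul_zero]

/-- The Frobenius of `R⁺`. -/
noncomputable def phiPlus (p : ℕ) [Fact p.Prime] : plus p →ₐ[ℚ_[p]] plus p :=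
  ((phi p).comp (plus p).val).codRestrict (plus p) fun f => phi_mem_plus f.2

/-- Coefficients of `log (1 + X)`. -/
noncomputable def logCoeff (p : ℕ) [Fact p.Prime] (n : ℤ) : ℚ_[p] :=
  if 0 < n then (-1) ^ (n.toNat + 1) / (n : ℚ_[p]) else 0

theorem norm_natCast_inv_le {p : ℕ} [hp : Fact p.Prime] {n : ℕ} (hn : n ≠ 0) :
    ‖(n : ℚ_[p])‖⁻¹ ≤ n := by
  rw [Padic.norm_eq_zpow_neg_valuation (by exact_mod_cast hn), Padic.valuation_natCast, zpow_neg,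
    inv_inv, zpow_natCast]
  exact_mod_cast Nat.le_of_dvd (Nat.pos_of_ne_zero hn) pow_padicValNat_dvd

theorem logCoeff_mem (p : ℕ) [hp : Fact p.Prime] : logCoeff p ∈ annulusSeries p := by
  refine ⟨1 / 2, by norm_num, by norm_num, fun σ h0 h1 => ?_⟩
  have h0' : 0 < σ := lt_of_lt_of_le (by norm_num) h0
  unfold ConvergesAt
  rw [Int.cofinite_eq, tendsto_sup]
  constructor
  · apply tendsto_const_nhds.congr'
    filter_upwards [eventually_le_atBot (0 : ℤ)] with n hn
    rw [logCoeff, if_neg (by omega)]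
    simp
  · have h3 : Tendsto (fun n : ℕ => (n : ℝ) * σ ^ n) atTop (𝓝 0) :=
      tendsto_self_mul_const_pow_of_lt_one h0'.le h1
    have h4 : Tendsto (fun n : ℤ => n.toNat) atTop atTop := by
      refine tendsto_atTop.2 fun N => ?_
      filter_upwards [eventually_ge_atTop (N : ℤ)] with n hn
      omega
    refine squeeze_zero' (Eventually.of_forall fun n => by positivity) ?_ (h3.comp h4)
    filter_upwards [eventually_gt_atTop (0 : ℤ)] with n hn
    obtain ⟨m, rfl⟩ : ∃ m : ℕ, n = m := ⟨n.toNat, by omega⟩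
    simp only [Function.comp, Int.toNat_natCast, zpow_natCast, logCoeff, if_pos hn, norm_div,
      norm_pow, norm_neg, norm_one, one_pow, one_div, Int.cast_natCast]
    exact mul_le_mul_of_nonneg_right (norm_natCast_inv_le (by omega)) (by positivity)

/-- `t = log (1 + X)`. -/
noncomputable def t (p : ℕ) [Fact p.Prime] : Robba p := ofCoeff (logCoeff p) (logCoeff_mem p)

theorem t_mem_plus (p : ℕ) [Fact p.Prime] : t p ∈ plus p := by
  apply mem_plus_of_neg
  intro n hn
  show logCoeff p n = 0
  rw [logCoeff, if_neg (by omega)]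

theorem log_subst_phi (p : ℕ) [hp : Fact p.Prime] :
    PowerSeries.HasSubst (phiPoly p : PowerSeries ℚ_[p]) ∧
    (PowerSeries.log ℚ_[p]).subst (phiPoly p : PowerSeries ℚ_[p]) =
      (p : ℚ_[p]) • PowerSeries.log ℚ_[p] := by
  have hc : PowerSeries.constantCoeff (phiPoly p : PowerSeries ℚ_[p]) = 0 := by
    rw [← PowerSeries.coeff_zero_eq_constantCoeff_apply, Polynomial.coeff_coe, coeff_phiPoly]
    simp
  have hs : PowerSeries.HasSubst (phiPoly p : PowerSeries ℚ_[p]) :=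
    PowerSeries.HasSubst.of_constantCoeff_zero' hc
  refine ⟨hs, ?_⟩
  have hΦ : (phiPoly p : PowerSeries ℚ_[p]) = (1 + PowerSeries.X) ^ p - 1 := by
    simp [phiPoly]
  set L := PowerSeries.derivative ℚ_[p] (PowerSeries.log ℚ_[p]) with hL
  have hL1 : (1 + PowerSeries.X) * L = 1 := by
    rw [hL, PowerSeries.deriv_log]
    ext n
    rw [add_mul, one_mul, map_add]
    cases n with
    | zero => simp
    | succ n =>
      rw [PowerSeries.coeff_succ_X_mul, PowerSeries.coeff_mk, PowerSeries.coeff_mk,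
        PowerSeries.coeff_one, if_neg (by omega)]
      simp [pow_succ]
  have hL2 : (1 + PowerSeries.X) ^ p * L.subst (phiPoly p : PowerSeries ℚ_[p]) = 1 := by
    have h := congrArg (PowerSeries.substAlgHom (R := ℚ_[p]) hs) hL1
    rw [map_mul, map_add, map_one, PowerSeries.coe_substAlgHom, PowerSeries.subst_X hs] at h
    have h1 : (1 + PowerSeries.X : PowerSeries ℚ_[p]) ^ p = 1 + (phiPoly p : PowerSeries ℚ_[p]) := by
      rw [hΦ]; ring
    rw [h1]
    exact h
  have hD : PowerSeries.derivative ℚ_[p] (phiPoly p : PowerSeries ℚ_[p]) =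
      (p : PowerSeries ℚ_[p]) * (1 + PowerSeries.X) ^ (p - 1) := by
    rw [hΦ]
    simp [Derivation.leibniz_pow, PowerSeries.derivative_X]
  have hpp : (1 + PowerSeries.X : PowerSeries ℚ_[p]) ^ p =
      (1 + PowerSeries.X) ^ (p - 1) * (1 + PowerSeries.X) := by
    rw [← pow_succ, Nat.sub_add_cancel hp.out.pos]
  have hsm : (p : ℚ_[p]) • PowerSeries.log ℚ_[p] =
      (p : PowerSeries ℚ_[p]) * PowerSeries.log ℚ_[p] := by
    rw [Algebra.smul_def]; simp
  apply PowerSeries.derivative.ext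
  · rw [PowerSeries.derivative_subst hs, ← hL, hD, Derivation.map_smul, ← hL]
    have hsm' : (p : ℚ_[p]) • L = (p : PowerSeries ℚ_[p]) * L := by
      rw [Algebra.smul_def]; simp
    rw [hsm']
    set S := L.subst (phiPoly p : PowerSeries ℚ_[p])
    have e1 : L = L * ((1 + PowerSeries.X) ^ p * S) := by rw [hL2, mul_one]
    have e2 : S * (1 + PowerSeries.X) ^ (p - 1) = L := by
      rw [e1, hpp]
      linear_combination (-(S * (1 + PowerSeries.X) ^ (p - 1))) * hL1
    rw [← e2]; ring
  · refine (PowerSeries.constantCoeff_subst_eq_zero hc _ PowerSeries.constantCoeff_log).trans ?_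
    simp

theorem logCoeff_natCast (p : ℕ) [hp : Fact p.Prime] (k : ℕ) :
    logCoeff p k = PowerSeries.coeff k (PowerSeries.log ℚ_[p]) := by
  rw [PowerSeries.coeff_log, logCoeff]
  split_ifs <;> first | omega | simp

theorem phi_t (p : ℕ) [hp : Fact p.Prime] : phi p (t p) = (p : ℚ_[p]) • t p := by
  apply ext_coeff
  ext n
  rcases lt_or_ge n 0 with hn | hn
  · rw [(phi_mem_plus (t_mem_plus p)).1 n hn, coeff_smul, Pi.smul_apply,
      (t_mem_plus p).1 n hn, smul_zero]
  obtain ⟨m, rfl⟩ : ∃ m : ℕ, n = m := ⟨n.toNat, by omega⟩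
  obtain ⟨hs, hlog⟩ := log_subst_phi p
  have h := congrArg (PowerSeries.coeff m) hlog
  rw [PowerSeries.coeff_subst' hs, PowerSeries.coeff_smul, ← logCoeff_natCast] at h
  rw [coeff_phi, coeff_smul, Pi.smul_apply]
  show ∑' k : ℤ, logCoeff p k * phiCoeff k m = (p : ℚ_[p]) • logCoeff p m
  rw [← h]
  have hinj : Function.Injective (fun i : ℕ => (i : ℤ)) := Nat.cast_injective
  rw [← hinj.tsum_eq]
  swap
  · intro k hk
    rw [Function.mem_support] at hk
    rcases lt_or_ge k 0 with hk0 | hk0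
    · exfalso
      apply hk
      rw [logCoeff, if_neg (by omega), zero_mul]
    · exact ⟨k.toNat, by simp only; omega⟩
  have hterm : ∀ k : ℕ, logCoeff p k * phiCoeff k m =
      PowerSeries.coeff k (PowerSeries.log ℚ_[p]) •
        PowerSeries.coeff m ((phiPoly p : PowerSeries ℚ_[p]) ^ k) := by
    intro k
    rw [logCoeff_natCast, phiCoeff_natCast, if_pos (by omega), Int.toNat_natCast, smul_eq_mul,
      ← Polynomial.coe_pow, Polynomial.coeff_coe]
  simp only [hterm]
  exact tsum_eq_finsum (PowerSeries.coeff_subst_finite' hs _ _)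

/-- `t` as an element of `R⁺`. -/
noncomputable def tPlus (p : ℕ) [Fact p.Prime] : plus p := ⟨t p, t_mem_plus p⟩

/-- The element `1 + X` of `R⁺`. -/
noncomputable def onePlusX (p : ℕ) [Fact p.Prime] : plus p :=
  ⟨1 + X p, add_mem (one_mem _) (mem_plus_of_neg fun n hn => by
    show (Pi.single 1 1 : ℤ → ℚ_[p]) n = 0
    exact Pi.single_eq_of_ne (by omega) _)⟩

theorem phiPlus_t (p : ℕ) [Fact p.Prime] : phiPlus p (tPlus p) = (p : ℚ_[p]) • tPlus p :=
  Subtype.ext (phi_t p)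

/-- `R[1/t]`. -/
abbrev InvT (p : ℕ) [Fact p.Prime] : Type := Localization.Away (t p)

/-- `R⁺[1/t]`. -/
abbrev PlusInvT (p : ℕ) [Fact p.Prime] : Type := Localization.Away (tPlus p)

theorem isUnit_algebraMap_smul {p : ℕ} [hp : Fact p.Prime] {A : Type*} [CommRing A]
    [Algebra ℚ_[p] A] {f : A →ₐ[ℚ_[p]] A} {s : A} (h : f s = (p : ℚ_[p]) • s) :
    IsUnit (((IsScalarTower.toAlgHom ℚ_[p] A (Localization.Away s)).comp f) s) := by
  rw [AlgHom.comp_apply, h, map_smul, Algebra.smul_def]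
  refine IsUnit.mul ?_ (IsLocalization.Away.algebraMap_isUnit s)
  exact (IsUnit.mk0 (p : ℚ_[p]) (by exact_mod_cast hp.out.ne_zero)).map _

/-- The extension of `φ` to `R[1/t]`. -/
noncomputable def phiInvT (p : ℕ) [Fact p.Prime] : InvT p →ₐ[ℚ_[p]] InvT p :=
  IsLocalization.Away.liftAlgHom (t p)
    (f := (IsScalarTower.toAlgHom ℚ_[p] (Robba p) (InvT p)).comp (phi p))
    (isUnit_algebraMap_smul (phi_t p))

/-- The extension of `φ` to `R⁺[1/t]`. -/
noncomputable def phiPlusInvT (p : ℕ) [Fact p.Prime] : PlusInvT p →ₐ[ℚ_[p]] PlusInvT p :=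
  IsLocalization.Away.liftAlgHom (tPlus p)
    (f := (IsScalarTower.toAlgHom ℚ_[p] (plus p) (PlusInvT p)).comp (phiPlus p))
    (isUnit_algebraMap_smul (phiPlus_t p))

/-- The natural map `R⁺[1/t] → R[1/t]`. -/
noncomputable def inclInvT (p : ℕ) [Fact p.Prime] : PlusInvT p →ₐ[ℚ_[p]] InvT p :=
  IsLocalization.Away.liftAlgHom (tPlus p)
    (f := (IsScalarTower.toAlgHom ℚ_[p] (Robba p) (InvT p)).comp (plus p).val)
    (IsLocalization.Away.algebraMap_isUnit (t p))

/-- `id ⊗ φ` on `E ⊗ R[1/t]`. -/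
noncomputable def phiE (p : ℕ) [Fact p.Prime] (E : Type*) [Field E] [Algebra ℚ_[p] E] :
    E ⊗[ℚ_[p]] InvT p →ₐ[E] E ⊗[ℚ_[p]] InvT p :=
  Algebra.TensorProduct.map (AlgHom.id E E) (phiInvT p)

/-- `id ⊗ φ` on `E ⊗ R⁺[1/t]`. -/
noncomputable def phiPlusE (p : ℕ) [Fact p.Prime] (E : Type*) [Field E] [Algebra ℚ_[p] E] :
    E ⊗[ℚ_[p]] PlusInvT p →ₐ[E] E ⊗[ℚ_[p]] PlusInvT p :=
  Algebra.TensorProduct.map (AlgHom.id E E) (phiPlusInvT p)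

/-- The natural map `E ⊗ R⁺[1/t] → E ⊗ R[1/t]`. -/
noncomputable def inclE (p : ℕ) [Fact p.Prime] (E : Type*) [Field E] [Algebra ℚ_[p] E] :
    E ⊗[ℚ_[p]] PlusInvT p →ₐ[E] E ⊗[ℚ_[p]] InvT p :=
  Algebra.TensorProduct.map (AlgHom.id E E) (inclInvT p)

/-- `1 + X` in `E ⊗ R[1/t]`. -/
noncomputable def uE (p : ℕ) [Fact p.Prime] (E : Type*) [Field E] [Algebra ℚ_[p] E] :
    E ⊗[ℚ_[p]] InvT p :=
  1 ⊗ₜ algebraMap (Robba p) (InvT p) (1 + X p)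

/-- `1 + X` in `E ⊗ R⁺[1/t]`. -/
noncomputable def uPlusE (p : ℕ) [Fact p.Prime] (E : Type*) [Field E] [Algebra ℚ_[p] E] :
    E ⊗[ℚ_[p]] PlusInvT p :=
  1 ⊗ₜ algebraMap (plus p) (PlusInvT p) (onePlusX p)

/-- `y = ∑_{i < p} φ(cᵢ) uⁱ`, where `u` is `1 + X` in the ring `A`. -/
def IsDecomposition {p : ℕ} {A : Type*} [CommRing A] (φ : A → A) (u y : A) (c : Fin p → A) :
    Prop :=
  y = ∑ i : Fin p, φ (c i) * u ^ (i : ℕ)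

open Classical in
/-- The operator `ψ`: if `y = ∑_{i < p} φ(yᵢ) uⁱ` with uniquely determined `yᵢ`, then `ψ(y) = y₀`.
(The value `0` is used when there is no such decomposition or more than one.) -/
noncomputable def psi (p : ℕ) [hp : Fact p.Prime] {A : Type*} [CommRing A] (φ : A → A) (u y : A) :
    A :=
  if h : ∃! c : Fin p → A, IsDecomposition φ u y c then h.choose ⟨0, hp.out.pos⟩ else 0

/-- `ψ` on `E ⊗ R[1/t]`. -/
noncomputable def psiE (p : ℕ) [Fact p.Prime] (E : Type*) [Field E] [Algebra ℚ_[p] E] :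
    E ⊗[ℚ_[p]] InvT p → E ⊗[ℚ_[p]] InvT p :=
  psi p (phiE p E) (uE p E)

/-- `ψ` on `E ⊗ R⁺[1/t]`. -/
noncomputable def psiPlusE (p : ℕ) [Fact p.Prime] (E : Type*) [Field E] [Algebra ℚ_[p] E] :
    E ⊗[ℚ_[p]] PlusInvT p → E ⊗[ℚ_[p]] PlusInvT p :=
  psi p (phiPlusE p E) (uPlusE p E)

end Robba

namespace Robba

/-! The heart of the matter is an estimate on negative exponents. At a radius σ close to 1, the
series φ(X)^q X^r differs from X^(pq+r) by something smaller by the factor σ, because the middle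
binomial coefficients are divisible by p. Hence sending X^(pq+r) to φ(X)^q X^r defines an invertible
isometry (`IsPerturbation`), and every f in R is uniquely ∑ φ(c_r) X^r (`bijective_sum_phi`). The
map also respects the splitting into negative and nonnegative exponents (`combine_negPart`), so R⁺
has the same decompositions, and the negative parts of the c_r are controlled by the negative part
of f alone.

Quantitatively, ψ enlarges negative parts, measured at radius σ^p, by at most the factor p. If a
vector f satisfies f = Cψ(f) with all entries of C smaller than 1/p, iterating shows that its
negative part vanishes (`mem_plus_of_small_matrix`). An arbitrary constant matrix B is made small
with the help of t: since φ(t) = pt, one has ψ(t^n f) = p^(-n) t^n ψ(f), so f = Bψ(f) becomes t^n f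
= p^n B ψ(t^n f), and p^n B tends to 0. Thus t^n f lies in R⁺ for some n
(`exists_pow_mul_mem_plus`).

A basis of E over ℚ_p turns ψ(f) = αf into such a system, with B the matrix of multiplication by α⁻¹
(`mem_range_inclE`). Powers of X and of 1 + X are exchanged by a Taylor shift (`shiftEquiv`);
decompositions pass to the localizations by clearing denominators (`HasDecomp.localization`) and to
E ⊗ - by tensoring (`HasDecomp.tensor`). -/

/-! ### Weighted convergence of families of series. -/

/-- Only finitely many k have weight at least ε, and each of them contributes finitely many n. This
joint decay is what licenses the later exchanges of sums. -/
theorem ConvergesAt.tendsto_weight {p : ℕ} [Fact p.Prime] {κ : Type*} {F : κ → ℤ → ℚ_[p]}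
    {w : κ → ℝ} {σ : ℝ} (hσ : 0 < σ) (hF : ∀ k, ConvergesAt (F k) σ)
    (hw : Tendsto w cofinite (𝓝 0)) (hb : ∀ k n, ‖F k n‖ * σ ^ n ≤ w k) :
    Tendsto (fun x : ℤ × κ => ‖F x.2 x.1‖ * σ ^ x.1) cofinite (𝓝 0) := by
  rw [Metric.tendsto_nhds] at hw ⊢
  intro ε hε
  have h1 := hw ε hε
  rw [eventually_cofinite] at h1 ⊢
  have h2 : ∀ k, {n : ℤ | ¬ dist (‖F k n‖ * σ ^ n) 0 < ε}.Finite := fun k =>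
    eventually_cofinite.1 (Metric.tendsto_nhds.1 (hF k) ε hε)
  refine (h1.biUnion fun k _ => (h2 k).image fun n => (n, k)).subset ?_
  rintro ⟨n, k⟩ hnk
  rw [Set.mem_iUnion₂]
  refine ⟨k, fun hlt => hnk ?_, n, hnk, rfl⟩
  rw [dist_zero_right] at hlt ⊢
  rw [Real.norm_of_nonneg (by positivity)]
  exact (hb k n).trans_lt ((le_abs_self _).trans_lt hlt)

theorem ConvergesAt.exists_bound {p : ℕ} [Fact p.Prime] {a : ℤ → ℚ_[p]} {σ : ℝ}
    (ha : ConvergesAt a σ) : ∃ M, ∀ n, ‖a n‖ * σ ^ n ≤ M := by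
  obtain ⟨M, hM⟩ := ha.bddAbove_range_of_cofinite
  exact ⟨M, fun n => hM ⟨n, rfl⟩⟩

theorem ConvergesAt.sub {p : ℕ} [Fact p.Prime] {a b : ℤ → ℚ_[p]} {σ : ℝ} (hσ : 0 < σ)
    (ha : ConvergesAt a σ) (hb : ConvergesAt b σ) : ConvergesAt (a - b) σ := by
  have h := ha.add hσ (hb.smul (-1))
  rwa [neg_one_smul, ← sub_eq_add_neg] at h

theorem ConvergesAt.of_norm_le {p : ℕ} [Fact p.Prime] {a b : ℤ → ℚ_[p]} {σ : ℝ} (hσ : 0 < σ)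
    (ha : ConvergesAt a σ) (h : ∀ n, ‖b n‖ ≤ ‖a n‖) : ConvergesAt b σ :=
  squeeze_zero (fun n => by positivity)
    (fun n => mul_le_mul_of_nonneg_right (h n) (by positivity)) ha

/-! ### Perturbations of the monomials and Neumann series. -/

/-- A family of series `eₙ` whose distance to `X ^ n` at radius `σ` is at most `σ` times the
size of `X ^ n`. -/
structure IsPerturbation {p : ℕ} [Fact p.Prime] (e : ℤ → ℤ → ℚ_[p]) (σ : ℝ) : Prop where
  pos : 0 < σ
  lt_one : σ < 1
  conv : ∀ n, ConvergesAt (e n) σ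
  bound : ∀ n l, ‖e n l - (Pi.single n 1 : ℤ → ℚ_[p]) l‖ * σ ^ l ≤ σ * σ ^ n

/-- The coefficients of `∑ aₙ eₙ`. -/
noncomputable def combine {p : ℕ} [Fact p.Prime] (e : ℤ → ℤ → ℚ_[p]) (a : ℤ → ℚ_[p]) (l : ℤ) :
    ℚ_[p] :=
  ∑' n : ℤ, a n * e n l

namespace IsPerturbation

variable {p : ℕ} [Fact p.Prime] {e : ℤ → ℤ → ℚ_[p]} {σ : ℝ}

theorem norm_le (h : IsPerturbation e σ) (n l : ℤ) : ‖e n l‖ * σ ^ l ≤ σ ^ n := by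
  have h0 := h.pos
  have h1 : ‖(Pi.single n 1 : ℤ → ℚ_[p]) l‖ * σ ^ l ≤ σ ^ n := by
    rw [Pi.single_apply]
    split_ifs with hn
    · simp [hn]
    · simp; positivity
  have h2 : ‖e n l - (Pi.single n 1 : ℤ → ℚ_[p]) l‖ * σ ^ l ≤ σ ^ n :=
    (h.bound n l).trans (mul_le_of_le_one_left (by positivity) h.lt_one.le)
  have hp : 0 < σ ^ l := zpow_pos h0 l
  rw [← le_div_iff₀ hp] at *
  calc ‖e n l‖ = ‖(e n l - (Pi.single n 1 : ℤ → ℚ_[p]) l) + (Pi.single n 1 : ℤ → ℚ_[p]) l‖ := by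
        rw [sub_add_cancel]
    _ ≤ _ := (IsUltrametricDist.norm_add_le_max _ _).trans (max_le h2 h1)

theorem tendsto_combine_weight (h : IsPerturbation e σ) {a : ℤ → ℚ_[p]} (ha : ConvergesAt a σ) :
    Tendsto (fun x : ℤ × ℤ => ‖a x.2 * e x.2 x.1‖ * σ ^ x.1) cofinite (𝓝 0) := by
  have h0 := h.pos
  refine ConvergesAt.tendsto_weight (F := fun k n => a k * e k n) h0
    (fun k => (h.conv k).smul (a k)) ha fun k n => ?_
  rw [norm_mul, mul_assoc]
  exact mul_le_mul_of_nonneg_left (h.norm_le k n) (norm_nonneg _)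

theorem convergesAt_combine (h : IsPerturbation e σ) {a : ℤ → ℚ_[p]} (ha : ConvergesAt a σ) :
    ConvergesAt (combine e a) σ :=
  convergesAt_tsum (F := fun l n => a n * e n l) h.pos (h.tendsto_combine_weight ha)

theorem summable_combine (h : IsPerturbation e σ) {a : ℤ → ℚ_[p]} (ha : ConvergesAt a σ)
    (l : ℤ) : Summable fun n => a n * e n l := by
  refine summable_of_weight (σ ^ l)⁻¹
    ((h.tendsto_combine_weight ha).comp (Prod.mk_right_injective l).tendsto_cofinite) ?_
  intro k
  have hp : 0 < σ ^ l := zpow_pos h.pos l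
  simp only [Function.comp]
  field_simp
  exact le_rfl

theorem combine_sub (h : IsPerturbation e σ) {a b : ℤ → ℚ_[p]} (ha : ConvergesAt a σ)
    (hb : ConvergesAt b σ) : combine e (a - b) = combine e a - combine e b := by
  ext l
  simp only [combine, Pi.sub_apply, sub_mul]
  exact (h.summable_combine ha l).tsum_sub (h.summable_combine hb l)

/-- Writing a as ∑ aₙ Xⁿ and subtracting termwise, the ultrametric inequality shows that 1 -
`combine e` contracts by the factor σ. -/
theorem norm_combine_sub_le (h : IsPerturbation e σ) {a : ℤ → ℚ_[p]} (ha : ConvergesAt a σ)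
    {M : ℝ} (hM : ∀ n, ‖a n‖ * σ ^ n ≤ M) (l : ℤ) :
    ‖combine e a l - a l‖ * σ ^ l ≤ σ * M := by
  have h0 := h.pos
  have hM0 : 0 ≤ M := le_trans (by positivity) (hM 0)
  have hs : HasSum (fun n => a n * (Pi.single n 1 : ℤ → ℚ_[p]) l) (a l) := by
    have := hasSum_single (f := fun n => a n * (Pi.single n 1 : ℤ → ℚ_[p]) l) l
      fun n hn => by simp [Pi.single_eq_of_ne hn.symm]
    simpa using this
  have hd := ((h.summable_combine ha l).hasSum.sub hs).tsum_eq
  have hp : 0 < σ ^ l := zpow_pos h0 l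
  unfold combine
  rw [← hd, ← le_div_iff₀ hp]
  refine IsUltrametricDist.norm_tsum_le_of_forall_le_of_nonneg (by positivity) fun n => ?_
  rw [le_div_iff₀ hp, ← mul_sub, norm_mul, mul_assoc]
  calc _ ≤ ‖a n‖ * (σ * σ ^ n) := mul_le_mul_of_nonneg_left (h.bound n l) (norm_nonneg _)
    _ = σ * (‖a n‖ * σ ^ n) := by ring
    _ ≤ σ * M := mul_le_mul_of_nonneg_left (hM n) h0.le

/-- If S is the supremum of the weighted coefficients of a, the contraction estimate gives S ≤
max(B, σS), and σ < 1 forces S ≤ B. This serves twice: for injectivity (B = 0), and to bound the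
components of a series by the series itself. -/
theorem norm_le_of_norm_combine_le (h : IsPerturbation e σ) {a : ℤ → ℚ_[p]}
    (ha : ConvergesAt a σ) {B : ℝ} (hB : ∀ n, ‖combine e a n‖ * σ ^ n ≤ B) (n : ℤ) :
    ‖a n‖ * σ ^ n ≤ B := by
  have h0 := h.pos
  have hB0 : 0 ≤ B := le_trans (by positivity) (hB 0)
  have hbdd : BddAbove (Set.range fun n => ‖a n‖ * σ ^ n) := ha.bddAbove_range_of_cofinite
  set S := ⨆ n, ‖a n‖ * σ ^ n with hS
  have hle : ∀ n, ‖a n‖ * σ ^ n ≤ S := fun n => le_ciSup hbdd n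
  have hmax : S ≤ max B (σ * S) := by
    refine ciSup_le fun n => ?_
    have h1 := h.norm_combine_sub_le ha hle n
    have hp : 0 < σ ^ n := zpow_pos h0 n
    have h2 := hB n
    have h3 : ‖a n‖ ≤ max ‖combine e a n‖ ‖combine e a n - a n‖ := by
      conv_lhs => rw [← sub_sub_cancel (combine e a n) (a n)]
      rw [sub_eq_add_neg, ← norm_neg (combine e a n - a n)]
      exact IsUltrametricDist.norm_add_le_max _ _
    calc _ ≤ (max ‖combine e a n‖ ‖combine e a n - a n‖) * σ ^ n :=
          mul_le_mul_of_nonneg_right h3 hp.le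
      _ = _ := max_mul_of_nonneg _ _ hp.le
      _ ≤ _ := max_le_max h2 h1
  refine (hle n).trans ?_
  rcases le_max_iff.1 hmax with h1 | h1
  · exact h1
  · nlinarith [h.lt_one]

theorem eq_zero_of_combine_eq_zero (h : IsPerturbation e σ) {a : ℤ → ℚ_[p]}
    (ha : ConvergesAt a σ) (hz : combine e a = 0) : a = 0 := by
  ext n
  have h1 := h.norm_le_of_norm_combine_le ha (B := 0) (by simp [hz]) n
  have hp : 0 < σ ^ n := zpow_pos h.pos n
  have h2 : ‖a n‖ ≤ 0 := by
    by_contra hlt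
    exact absurd h1 (not_le.2 (mul_pos (not_le.1 hlt) hp))
  simpa using h2

/-- The Neumann iterates of the operator `combine e` at `f`. -/
noncomputable def neumann (e : ℤ → ℤ → ℚ_[p]) (f : ℤ → ℚ_[p]) : ℕ → ℤ → ℚ_[p]
  | 0 => f
  | k + 1 => neumann e f k - combine e (neumann e f k)

theorem convergesAt_neumann (h : IsPerturbation e σ) {f : ℤ → ℚ_[p]} (hf : ConvergesAt f σ)
    (k : ℕ) : ConvergesAt (neumann e f k) σ := by
  induction k with
  | zero => exact hf
  | succ k ih => exact ih.sub h.pos (h.convergesAt_combine ih)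

theorem norm_neumann_le (h : IsPerturbation e σ) {f : ℤ → ℚ_[p]} (hf : ConvergesAt f σ)
    {M : ℝ} (hM : ∀ n, ‖f n‖ * σ ^ n ≤ M) (k : ℕ) (n : ℤ) :
    ‖neumann e f k n‖ * σ ^ n ≤ σ ^ k * M := by
  induction k generalizing n with
  | zero => simpa [neumann] using hM n
  | succ k ih =>
    rw [neumann, Pi.sub_apply, norm_sub_rev, pow_succ', mul_assoc]
    exact h.norm_combine_sub_le (h.convergesAt_neumann hf k) ih n

theorem tendsto_neumann_weight (h : IsPerturbation e σ) {f : ℤ → ℚ_[p]} (hf : ConvergesAt f σ) :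
    Tendsto (fun x : ℤ × ℕ => ‖neumann e f x.2 x.1‖ * σ ^ x.1) cofinite (𝓝 0) := by
  obtain ⟨M, hM⟩ := hf.exists_bound
  refine ConvergesAt.tendsto_weight h.pos (h.convergesAt_neumann hf) ?_ (h.norm_neumann_le hf hM)
  rw [Nat.cofinite_eq_atTop]
  simpa using (tendsto_pow_atTop_nhds_zero_of_lt_one h.pos.le h.lt_one).mul_const M

/-- The preimage of `f` under `combine e`. -/
noncomputable def preimage (e : ℤ → ℤ → ℚ_[p]) (f : ℤ → ℚ_[p]) (n : ℤ) : ℚ_[p] :=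
  ∑' k : ℕ, neumann e f k n

theorem convergesAt_preimage (h : IsPerturbation e σ) {f : ℤ → ℚ_[p]} (hf : ConvergesAt f σ) :
    ConvergesAt (preimage e f) σ :=
  convergesAt_tsum (F := fun n k => neumann e f k n) h.pos (h.tendsto_neumann_weight hf)

/-- The image of the k-th Neumann iterate is the difference of the k-th and (k+1)-st, so the sum
telescopes to the iterate of index 0. -/
theorem combine_preimage (h : IsPerturbation e σ) {f : ℤ → ℚ_[p]} (hf : ConvergesAt f σ) :
    combine e (preimage e f) = f := by
  have h0 := h.pos
  ext l
  have hpl : 0 < σ ^ l := zpow_pos h0 l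
  have hS : Summable fun x : ℤ × ℕ => neumann e f x.2 x.1 * e x.1 l := by
    refine summable_of_weight (σ ^ l)⁻¹ (h.tendsto_neumann_weight hf) fun x => ?_
    rw [le_inv_mul_iff₀ hpl, norm_mul]
    calc _ = ‖neumann e f x.2 x.1‖ * (‖e x.1 l‖ * σ ^ l) := by ring
      _ ≤ _ := mul_le_mul_of_nonneg_left (h.norm_le _ _) (norm_nonneg _)
  have hN : Summable fun k => neumann e f k l := by
    refine summable_of_weight (σ ^ l)⁻¹
      ((h.tendsto_neumann_weight hf).comp (Prod.mk_right_injective l).tendsto_cofinite) fun k => ?_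
    rw [le_inv_mul_iff₀ hpl, mul_comm]
    exact le_rfl
  calc combine e (preimage e f) l = ∑' n, ∑' k, neumann e f k n * e n l := by
        unfold combine preimage
        exact tsum_congr fun n => tsum_mul_right.symm
    _ = ∑' k, combine e (neumann e f k) l :=
        Summable.tsum_comm (f := fun k n => neumann e f k n * e n l)
          ((Equiv.prodComm ℕ ℤ).summable_iff.2 hS)
    _ = ∑' k, (neumann e f k l - neumann e f (k + 1) l) :=
        tsum_congr fun k => by rw [neumann, Pi.sub_apply, sub_sub_cancel]
    _ = f l := by
        rw [hN.tsum_sub ((summable_nat_add_iff 1).2 hN), hN.tsum_eq_zero_add]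
        simp [neumann]

end IsPerturbation

/-! ### Comparison of φ(X)^q X^r with monomials. -/

theorem coeff_monomial_mul {p : ℕ} [Fact p.Prime] (m : ℤ) (r : ℚ_[p]) (f : Robba p) (n : ℤ) :
    (monomial m r * f).coeff n = r * f.coeff (n - m) :=
  mulCoeff_single m r f.coeff n

theorem monomial_mul_monomial {p : ℕ} [Fact p.Prime] (m k : ℤ) (r : ℚ_[p]) :
    (monomial m 1 * monomial k r : Robba p) = monomial (m + k) r := by
  apply ext_coeff
  ext n
  rw [coeff_monomial_mul, one_mul]
  show (Pi.single k r : ℤ → ℚ_[p]) (n - m) = (Pi.single (m + k) r : ℤ → ℚ_[p]) n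
  simp only [Pi.single_apply, sub_eq_iff_eq_add']

theorem norm_coeff_add_le {p : ℕ} [Fact p.Prime] {f g : Robba p} {σ M : ℝ} (hσ : 0 < σ)
    (hf : ∀ n, ‖f.coeff n‖ * σ ^ n ≤ M) (hg : ∀ n, ‖g.coeff n‖ * σ ^ n ≤ M) (n : ℤ) :
    ‖(f + g).coeff n‖ * σ ^ n ≤ M := by
  have hp : 0 < σ ^ n := zpow_pos hσ n
  have h1 := hf n
  have h2 := hg n
  rw [← le_div_iff₀ hp] at *
  exact (IsUltrametricDist.norm_add_le_max _ _).trans (max_le h1 h2)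

theorem norm_coeff_neg {p : ℕ} [Fact p.Prime] (f : Robba p) (n : ℤ) :
    ‖(-f).coeff n‖ = ‖f.coeff n‖ := by
  rw [← neg_one_smul ℚ_[p] f, coeff_smul]
  simp

/-- Only the binomial terms of degree 0 < m < p remain; their coefficients have norm at most p⁻¹ ≤
σ^p, and the exponent m ≥ 1 supplies the extra factor σ. -/
theorem norm_coeff_phiX_sub_le {p : ℕ} [hp : Fact p.Prime] {σ : ℝ} (h0 : 0 < σ) (h1 : σ < 1)
    (h : (p : ℝ)⁻¹ ≤ σ ^ p) (n : ℤ) :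
    ‖(phiX p - monomial (p : ℤ) 1).coeff n‖ * σ ^ n ≤ σ * σ ^ p := by
  rw [coeff_sub, Pi.sub_apply, coeff_phiX]
  show ‖_ - (Pi.single (p : ℤ) 1 : ℤ → ℚ_[p]) n‖ * σ ^ n ≤ _
  split_ifs with hn
  · obtain ⟨m, rfl⟩ : ∃ m : ℕ, n = m := ⟨n.toNat, by omega⟩
    rw [Int.toNat_natCast, zpow_natCast]
    rcases lt_trichotomy m p with hm | hm | hm
    · rw [Pi.single_eq_of_ne (by omega), sub_zero, mul_comm]
      refine mul_le_mul ?_ ((norm_choose_le (by omega) hm).trans h) (norm_nonneg _) h0.le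
      exact pow_le_of_le_one h0.le h1.le (by omega)
    · subst hm
      simp
      positivity
    · rw [Pi.single_eq_of_ne (by omega), Nat.choose_eq_zero_of_lt hm]
      simp
      positivity
  · have := hp.out.pos
    rw [Pi.single_eq_of_ne (by omega)]
    simp
    positivity

/-- Induction in both directions on φ^(q+1) - X^(p(q+1)) = φ^q (φ - X^p) + X^p (φ^q - X^(pq)), with
φ standing for φ(X). -/
theorem norm_phiCoeff_sub_le {p : ℕ} [hp : Fact p.Prime] {σ : ℝ} (hσ : GoodRadius p σ)
    (h1 : σ < 1) (h : (p : ℝ)⁻¹ ≤ σ ^ p) (q n : ℤ) :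
    ‖(((phiUnit p ^ q : (Robba p)ˣ) : Robba p) - monomial (p * q) 1).coeff n‖ * σ ^ n ≤
      σ * (σ ^ p) ^ q := by
  have h0 := hσ.pos
  have hb := norm_coeff_phiX_sub_le h0 h1 h
  have hmul : ∀ q n : ℤ, ‖(((phiUnit p ^ q : (Robba p)ˣ) : Robba p) *
      (phiX p - monomial (p : ℤ) 1)).coeff n‖ * σ ^ n ≤ σ * (σ ^ p) ^ (q + 1) := by
    intro q n
    rw [coeff_mul]
    refine (bound_mul h0 (by positivity) (by positivity) (hσ.bound q) hb n).trans (le_of_eq ?_)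
    rw [zpow_add₀ (by positivity), zpow_one]
    ring
  have hval : ((phiUnit p : (Robba p)ˣ) : Robba p) = phiX p := rfl
  have hshift : ∀ (f : Robba p) (n : ℤ),
      (monomial (p : ℤ) 1 * f).coeff n * 1 = f.coeff (n - p) := by
    intro f n
    rw [coeff_monomial_mul, one_mul, mul_one]
  induction q using Int.induction_on generalizing n with
  | zero =>
    rw [zpow_zero, mul_zero]
    show ‖((1 : Robba p) - 1).coeff n‖ * σ ^ n ≤ _
    rw [sub_self, coeff_zero]
    simp
    positivity
  | succ k ih =>
    have e : ((phiUnit p ^ ((k : ℤ) + 1) : (Robba p)ˣ) : Robba p) - monomial (p * ((k : ℤ) + 1)) 1 =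
        ((phiUnit p ^ (k : ℤ) : (Robba p)ˣ) : Robba p) * (phiX p - monomial (p : ℤ) 1) +
        monomial (p : ℤ) 1 *
          (((phiUnit p ^ (k : ℤ) : (Robba p)ˣ) : Robba p) - monomial (p * (k : ℤ)) 1) := by
      rw [zpow_add_one, Units.val_mul, hval,
        show (p : ℤ) * ((k : ℤ) + 1) = p + p * k by ring, ← monomial_mul_monomial]
      ring
    rw [e]
    refine norm_coeff_add_le h0 (hmul k) (fun n => ?_) n
    rw [← mul_one ((monomial (p : ℤ) 1 * _ : Robba p).coeff n), hshift]
    have h2 := mul_le_mul_of_nonneg_right (ih (n - p)) (zpow_pos h0 (p : ℤ)).le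
    rw [mul_assoc, ← zpow_add₀ h0.ne', sub_add_cancel] at h2
    refine h2.trans (le_of_eq ?_)
    rw [mul_assoc, zpow_add_one₀ (by positivity), zpow_natCast σ p]
  | pred k ih =>
    -- The same identity solved for the term of lower index; the factor X^p is then removed by
    -- shifting exponents by p.
    have e : monomial (p : ℤ) 1 * (((phiUnit p ^ (-(k : ℤ) - 1) : (Robba p)ˣ) : Robba p) -
          monomial (p * (-(k : ℤ) - 1)) 1) =
        (((phiUnit p ^ (-(k : ℤ)) : (Robba p)ˣ) : Robba p) - monomial (p * (-(k : ℤ))) 1) +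
        -(((phiUnit p ^ (-(k : ℤ) - 1) : (Robba p)ˣ) : Robba p) *
          (phiX p - monomial (p : ℤ) 1)) := by
      have e1 : ((phiUnit p ^ (-(k : ℤ)) : (Robba p)ˣ) : Robba p) =
          ((phiUnit p ^ (-(k : ℤ) - 1) : (Robba p)ˣ) : Robba p) * phiX p := by
        rw [← hval, ← Units.val_mul, ← zpow_add_one, sub_add_cancel]
      rw [mul_sub, monomial_mul_monomial, show (p : ℤ) + p * (-(k : ℤ) - 1) = p * (-(k : ℤ)) by ring,
        e1]
      ring
    have h2 := norm_coeff_add_le h0 ih (g := -(((phiUnit p ^ (-(k : ℤ) - 1) : (Robba p)ˣ) :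
      Robba p) * (phiX p - monomial (p : ℤ) 1))) (fun n => by
        rw [norm_coeff_neg]
        simpa using hmul (-(k : ℤ) - 1) n) (n + p)
    rw [← e, ← mul_one ((monomial (p : ℤ) 1 * _ : Robba p).coeff _), hshift,
      add_sub_cancel_right, zpow_add₀ h0.ne', ← mul_assoc, zpow_natCast,
      ← le_div_iff₀ (by positivity)] at h2
    refine h2.trans (le_of_eq ?_)
    rw [zpow_sub_one₀ (by positivity)]
    field_simp

/-- The coefficients of `φ(X) ^ q X ^ r`, where `n = p q + r` and `0 ≤ r < p`. -/
noncomputable def phiBasis (p : ℕ) [Fact p.Prime] (n l : ℤ) : ℚ_[p] :=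
  phiCoeff (n / p) (l - n % p)

/-- Multiplication by X^r shifts exponents, so the estimate for φ(X)^q against X^(pq) becomes one
against X^n with n = pq + r. -/
theorem isPerturbation_phiBasis {p : ℕ} [hp : Fact p.Prime] {σ : ℝ} (hσ : GoodRadius p σ)
    (h1 : σ < 1) (h : (p : ℝ)⁻¹ ≤ σ ^ p) : IsPerturbation (phiBasis p) σ := by
  have h0 := hσ.pos
  refine ⟨h0, h1, fun n => ?_, fun n l => ?_⟩
  · have hinj : Function.Injective fun l : ℤ => l - n % p := sub_left_injective
    have h2 := ((hσ.conv (n / p)).comp hinj.tendsto_cofinite).mul_const (σ ^ (n % p))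
    rw [zero_mul] at h2
    refine h2.congr fun l => ?_
    simp only [Function.comp, phiBasis]
    rw [mul_assoc, ← zpow_add₀ h0.ne', sub_add_cancel]
  · have h2 := mul_le_mul_of_nonneg_right
      (norm_phiCoeff_sub_le hσ h1 h (n / p) (l - n % p)) (zpow_pos h0 (n % p)).le
    rw [mul_assoc, ← zpow_add₀ h0.ne', sub_add_cancel, mul_assoc, ← zpow_natCast σ p, ← zpow_mul,
      ← zpow_add₀ h0.ne', Int.mul_ediv_add_emod] at h2
    refine le_trans (le_of_eq ?_) h2
    rw [coeff_sub, Pi.sub_apply]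
    show _ = ‖phiCoeff (n / p) (l - n % p) -
      (Pi.single (p * (n / p)) 1 : ℤ → ℚ_[p]) (l - n % p)‖ * _
    congr 3
    simp only [Pi.single_apply, sub_eq_iff_eq_add, Int.mul_ediv_add_emod]

/-- The inequality p⁻¹ ≤ σ^p is kept because it later bounds the loss σ^(-r), for r < p, by p. -/
theorem eventually_isPerturbation (p : ℕ) [hp : Fact p.Prime] :
    ∀ᶠ σ in 𝓝[<] (1 : ℝ), IsPerturbation (phiBasis p) σ ∧ (p : ℝ)⁻¹ ≤ σ ^ p := by
  obtain ⟨ρ, h0, h1, h⟩ := exists_radius p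
  filter_upwards [Ioo_mem_nhdsLT h1] with σ hσ
  have h' : (p : ℝ)⁻¹ ≤ σ ^ p := h.trans (pow_le_pow_left₀ h0.le hσ.1.le p)
  exact ⟨isPerturbation_phiBasis (goodRadius_of h0 hσ.2 h hσ.1) hσ.2 h', h'⟩

/-- φ(X)⁻¹ is X^(-p) times a power series in 1/X, so its k-th power has no exponent above -pk. -/
theorem phiCoeff_neg_natCast_eq_zero {p : ℕ} [hp : Fact p.Prime] (k : ℕ) {n : ℤ}
    (hn : -(p * k : ℤ) < n) : phiCoeff (p := p) (-k) n = 0 := by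
  induction k generalizing n with
  | zero =>
    rw [Nat.cast_zero, neg_zero, phiCoeff_zero]
    exact Pi.single_eq_of_ne (by simp at hn; omega) _
  | succ k ih =>
    have e2 : phiCoeff (p := p) (-1) = invCoeff p := by
      ext n; unfold phiCoeff; rw [zpow_neg_one]; rfl
    rw [Nat.cast_succ, neg_add, phiCoeff_add, e2]
    unfold mulCoeff
    convert tsum_zero with m
    rcases lt_or_ge (-(p * k : ℤ)) m with hm | hm
    · rw [ih hm, zero_mul]
    · have : ¬ (n - m ≤ -p) := by
        push_cast at hn
        rw [mul_add] at hn
        omega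
      rw [invCoeff, if_neg this, mul_zero]

theorem phiBasis_eq_zero_of_neg {p : ℕ} [hp : Fact p.Prime] {n l : ℤ} (hn : n < 0) (hl : 0 ≤ l) :
    phiBasis p n l = 0 := by
  have hp0 : (0 : ℤ) < p := by exact_mod_cast hp.out.pos
  have hq : n / p < 0 := Int.ediv_neg_of_neg_of_pos hn hp0
  obtain ⟨k, hk⟩ : ∃ k : ℕ, n / p = -k := ⟨(-(n / p)).toNat, by omega⟩
  have h := Int.mul_ediv_add_emod n p
  unfold phiBasis
  rw [hk] at h ⊢
  rw [mul_neg] at h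
  exact phiCoeff_neg_natCast_eq_zero k (by omega)

theorem phiBasis_eq_zero_of_nonneg {p : ℕ} [hp : Fact p.Prime] {n l : ℤ} (hn : 0 ≤ n)
    (hl : l < 0) : phiBasis p n l = 0 := by
  have hp0 : (0 : ℤ) < p := by exact_mod_cast hp.out.pos
  obtain ⟨k, hk⟩ : ∃ k : ℕ, n / p = k := ⟨(n / p).toNat, by
    have := Int.ediv_nonneg hn hp0.le
    omega⟩
  have := Int.emod_nonneg n hp0.ne'
  rw [phiBasis, hk, phiCoeff_natCast, if_neg (by omega)]

/-! ### Negative parts. -/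

/-- The part of a bi-infinite series with negative exponents. -/
noncomputable def negPart {p : ℕ} [Fact p.Prime] (a : ℤ → ℚ_[p]) (n : ℤ) : ℚ_[p] :=
  if n < 0 then a n else 0

theorem norm_negPart_le {p : ℕ} [Fact p.Prime] (a : ℤ → ℚ_[p]) (n : ℤ) :
    ‖negPart a n‖ ≤ ‖a n‖ := by
  unfold negPart
  split_ifs <;> simp

/-- The basis series of index n < 0 involve only negative exponents and those of index n ≥ 0 only
nonnegative ones, so the two halves do not interact. -/
theorem combine_negPart {p : ℕ} [hp : Fact p.Prime] (a : ℤ → ℚ_[p]) :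
    combine (phiBasis p) (negPart a) = negPart (combine (phiBasis p) a) := by
  ext l
  unfold combine negPart
  split_ifs with hl
  · refine tsum_congr fun n => ?_
    split_ifs with hn
    · rfl
    · rw [phiBasis_eq_zero_of_nonneg (not_lt.1 hn) hl, mul_zero, mul_zero]
  · convert tsum_zero with n
    split_ifs with hn
    · rw [phiBasis_eq_zero_of_neg hn (not_lt.1 hl), mul_zero]
    · rw [zero_mul]


/-! ### Unique decomposition in the Robba ring. -/

theorem coeff_sum {p : ℕ} [Fact p.Prime] {ι : Type*} (s : Finset ι) (f : ι → Robba p) (n : ℤ) :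
    (∑ i ∈ s, f i).coeff n = ∑ i ∈ s, (f i).coeff n := by
  classical
  induction s using Finset.induction_on with
  | empty => rfl
  | insert i s hi ih => rw [Finset.sum_insert hi, Finset.sum_insert hi, ← ih]; rfl

/-- The coefficients of `∑ cᵣ(X ^ p) X ^ r`. -/
noncomputable def interleave {p : ℕ} [hp : Fact p.Prime] (c : Fin p → Robba p) (n : ℤ) : ℚ_[p] :=
  (c (Int.divModEquiv p n).2).coeff (Int.divModEquiv p n).1

theorem interleave_apply {p : ℕ} [hp : Fact p.Prime] (c : Fin p → Robba p) (q : ℤ) (r : Fin p) :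
    interleave c (q * p + r) = (c r).coeff q := by
  have h := (Int.divModEquiv p).apply_symm_apply (q, r)
  rw [Int.divModEquiv_symm_apply] at h
  unfold interleave
  rw [h]

theorem phiBasis_apply {p : ℕ} [hp : Fact p.Prime] (q l : ℤ) (r : Fin p) :
    phiBasis p (q * p + r) l = phiCoeff q (l - r) := by
  have hp0 : (0 : ℤ) < p := by exact_mod_cast hp.out.pos
  have hr : ((r : ℕ) : ℤ) < p := by exact_mod_cast r.2
  unfold phiBasis
  rw [add_comm, Int.add_mul_ediv_right _ _ hp0.ne', Int.add_mul_emod_self_right,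
    Int.ediv_eq_zero_of_lt (by positivity) hr, Int.emod_eq_of_lt (by positivity) hr, zero_add]

theorem interleave_injective {p : ℕ} [hp : Fact p.Prime] :
    Function.Injective (interleave (p := p)) := by
  intro c c' h
  ext r
  apply ext_coeff
  ext q
  rw [← interleave_apply, ← interleave_apply, h]

theorem convergesAt_interleave {p : ℕ} [hp : Fact p.Prime] {c : Fin p → Robba p} {σ : ℝ}
    (h0 : 0 < σ) (h1 : σ < 1) (hc : ∀ r, ConvergesAt (c r).coeff (σ ^ p)) :
    ConvergesAt (interleave c) σ := by
  choose M hM using fun r => (hc r).exists_bound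
  -- The index set `Fin p` is finite, so the decay condition on the weights is vacuous and any
  -- bounds `M` will do.
  have h := ConvergesAt.tendsto_weight (F := fun r => (c r).coeff) (w := M) (pow_pos h0 p) hc
    (by rw [cofinite_eq_bot]; exact tendsto_bot) hM
  unfold ConvergesAt
  refine squeeze_zero (fun n => by positivity) (fun n => ?_)
    (h.comp (Int.divModEquiv p).injective.tendsto_cofinite)
  obtain ⟨⟨q, r⟩, rfl⟩ := (Int.divModEquiv p).symm.surjective n
  rw [Function.comp, Equiv.apply_symm_apply, Int.divModEquiv_symm_apply, interleave_apply]
  refine mul_le_mul_of_nonneg_left ?_ (norm_nonneg _)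
  rw [zpow_add₀ h0.ne', mul_comm q, zpow_mul, zpow_natCast, zpow_natCast]
  exact mul_le_of_le_one_right (by positivity) (pow_le_one₀ h0.le h1.le)

theorem eventually_interleave {p : ℕ} [hp : Fact p.Prime] (c : Fin p → Robba p) :
    ∀ᶠ σ in 𝓝[<] (1 : ℝ), ConvergesAt (interleave c) σ := by
  have h : ∀ᶠ σ in 𝓝[<] (1 : ℝ), ∀ r, ConvergesAt (c r).coeff (σ ^ p) :=
    eventually_all.2 fun r => (tendsto_pow_left hp.out.ne_zero).eventually
      (mem_annulusSeries_iff.1 (c r).coeff_mem)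
  filter_upwards [h, eventually_isPerturbation p] with σ h1 h2
  exact convergesAt_interleave h2.1.pos h2.1.lt_one h1

theorem deinterleave_mem {p : ℕ} [hp : Fact p.Prime] {a : ℤ → ℚ_[p]} (ha : a ∈ annulusSeries p)
    (r : Fin p) : (fun q : ℤ => a (q * p + r)) ∈ annulusSeries p := by
  obtain ⟨ρ, h0, h1, h⟩ := ha
  have hp0 := hp.out.ne_zero
  refine ⟨ρ ^ p, by positivity, pow_lt_one₀ h0.le h1 hp0, fun τ hτ hτ1 => ?_⟩
  have hτ0 : 0 < τ := (pow_pos h0 p).trans_le hτ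
  -- Radius τ for a component corresponds to radius τ^(1/p) for the whole series, since q is the
  -- component exponent of X^(qp+r).
  obtain ⟨σ, hσ, rfl⟩ : ∃ σ : ℝ, 0 < σ ∧ σ ^ p = τ :=
    ⟨τ ^ ((p : ℝ)⁻¹), by positivity, Real.rpow_inv_natCast_pow hτ0.le hp0⟩
  have hle : ρ ≤ σ := le_of_pow_le_pow_left₀ hp0 hσ.le hτ
  have hlt : σ < 1 := lt_of_pow_lt_pow_left₀ p zero_le_one (by simpa using hτ1)
  have hinj : Function.Injective fun q : ℤ => q * p + (r : ℤ) := fun x y hxy => by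
    simpa [hp0] using hxy
  have h2 := ((h σ hle hlt).comp hinj.tendsto_cofinite).mul_const (σ ^ (r : ℕ))⁻¹
  rw [zero_mul] at h2
  refine h2.congr fun q => ?_
  simp only [Function.comp]
  rw [mul_assoc, zpow_add₀ hσ.ne', zpow_natCast, mul_assoc, mul_inv_cancel₀ (by positivity),
    mul_one, mul_comm q, zpow_mul, zpow_natCast]

/-- The coefficients of `∑ φ(cᵣ) X ^ r`. -/
theorem coeff_sum_phi {p : ℕ} [hp : Fact p.Prime] (c : Fin p → Robba p) :
    (∑ r : Fin p, phi p (c r) * X p ^ (r : ℕ)).coeff = combine (phiBasis p) (interleave c) := by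
  ext l
  obtain ⟨σ, hσ, hc⟩ := ((eventually_isPerturbation p).and (eventually_interleave c)).exists
  have hs := hσ.1.summable_combine hc l
  let e : Fin p × ℤ ≃ ℤ := (Equiv.prodComm _ _).trans (Int.divModEquiv p).symm
  have he : ∀ x, e x = x.2 * p + x.1 := fun x => Int.divModEquiv_symm_apply p (x.2, x.1)
  have hs' := e.summable_iff.2 hs
  rw [coeff_sum, combine, ← e.tsum_eq]
  refine Eq.trans ?_ hs'.tsum_prod.symm
  rw [tsum_fintype]
  refine Finset.sum_congr rfl fun r _ => ?_
  rw [mul_comm, X_pow, coeff_monomial_mul, one_mul, coeff_phi]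
  refine tsum_congr fun q => ?_
  simp only [Function.comp, he, interleave_apply, phiBasis_apply]

/-- By `coeff_sum_phi` this is invertibility of `combine (phiBasis p)`. The coefficients of the
preimage do not depend on σ, so convergence at every σ near 1 places it in the Robba ring. -/
theorem bijective_sum_phi (p : ℕ) [hp : Fact p.Prime] :
    Function.Bijective fun c : Fin p → Robba p => ∑ r : Fin p, phi p (c r) * X p ^ (r : ℕ) := by
  constructor
  · intro c c' h
    have h2 := congrArg coeff h
    simp only [coeff_sum_phi] at h2
    obtain ⟨σ, ⟨hσ, -⟩, hc, hc'⟩ := ((eventually_isPerturbation p).and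
      ((eventually_interleave c).and (eventually_interleave c'))).exists
    refine interleave_injective (sub_eq_zero.1 ?_)
    refine hσ.eq_zero_of_combine_eq_zero (hc.sub hσ.pos hc') ?_
    rw [hσ.combine_sub hc hc', h2, sub_self]
  · intro f
    have hev := (eventually_isPerturbation p).and (mem_annulusSeries_iff.1 f.coeff_mem)
    have ha : IsPerturbation.preimage (phiBasis p) f.coeff ∈ annulusSeries p := by
      rw [mem_annulusSeries_iff]
      filter_upwards [hev] with σ hσ
      exact hσ.1.1.convergesAt_preimage hσ.2
    obtain ⟨σ, ⟨hσ, -⟩, hf⟩ := hev.exists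
    refine ⟨fun r => ofCoeff _ (deinterleave_mem ha r), ext_coeff ?_⟩
    rw [coeff_sum_phi]
    refine Eq.trans ?_ (hσ.combine_preimage hf)
    congr 1
    ext n
    obtain ⟨⟨q, r⟩, rfl⟩ := (Int.divModEquiv p).symm.surjective n
    rw [Int.divModEquiv_symm_apply, interleave_apply]
    rfl

/-- The negative part of the interleaved components is sent to the negative part of the sum, which
is zero; injectivity of `combine` concludes. -/
theorem mem_plus_of_sum_phi_mem {p : ℕ} [hp : Fact p.Prime] {c : Fin p → Robba p}
    (h : ∑ r : Fin p, phi p (c r) * X p ^ (r : ℕ) ∈ plus p) (r : Fin p) : c r ∈ plus p := by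
  obtain ⟨σ, ⟨hσ, -⟩, hc⟩ := ((eventually_isPerturbation p).and (eventually_interleave c)).exists
  have h1 : negPart (interleave c) = 0 := by
    refine hσ.eq_zero_of_combine_eq_zero (hc.of_norm_le hσ.pos (norm_negPart_le _)) ?_
    rw [combine_negPart, ← coeff_sum_phi]
    ext n
    unfold negPart
    split_ifs with hn
    · exact h.1 n hn
    · rfl
  apply mem_plus_of_neg
  intro q hq
  have hr : ((r : ℕ) : ℤ) < p := by exact_mod_cast r.2
  have h2 : q * p + r < 0 := by nlinarith
  rw [← interleave_apply]
  have h3 := congrFun h1 (q * p + r)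
  rwa [negPart, if_pos h2] at h3

/-! ### Vanishing of the negative part. -/

/-- A vector of series equal to a sufficiently small matrix times its image under
`∑ φ(cᵣ) X ^ r ↦ ∑ (-1) ^ r cᵣ` has no negative exponents. -/
theorem mem_plus_of_small_matrix {p : ℕ} [hp : Fact p.Prime] {ι : Type*} [Fintype ι]
    {h : ι → Robba p} {c : ι → Fin p → Robba p} {C : ι → ι → ℚ_[p]}
    (hc : ∀ i, h i = ∑ r : Fin p, phi p (c i r) * X p ^ (r : ℕ))
    (hC : ∀ i, h i = ∑ j, C i j • ∑ r : Fin p, (-1 : ℚ_[p]) ^ (r : ℕ) • c j r)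
    {δ : ℝ} (hδ : δ * p < 1) (hCδ : ∀ i j, ‖C i j‖ ≤ δ) (i : ι) : h i ∈ plus p := by
  have hev : ∀ᶠ σ in 𝓝[<] (1 : ℝ), ∀ i, ConvergesAt (h i).coeff (σ ^ p) ∧
      ConvergesAt (interleave (c i)) σ ∧ ConvergesAt (h i).coeff σ :=
    eventually_all.2 fun i => ((tendsto_pow_left hp.out.ne_zero).eventually
      (mem_annulusSeries_iff.1 (h i).coeff_mem)).and ((eventually_interleave (c i)).and
        (mem_annulusSeries_iff.1 (h i).coeff_mem))
  obtain ⟨σ, ⟨hσ, hσp⟩, hconv⟩ := ((eventually_isPerturbation p).and hev).exists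
  have h0 := hσ.pos
  have hp0 : (0 : ℤ) < p := by exact_mod_cast hp.out.pos
  have hτ0 : 0 < σ ^ p := pow_pos h0 p
  have hδ0 : 0 ≤ δ := (norm_nonneg _).trans (hCδ i i)
  -- a bound for the negative parts at radius `σ ^ p` improves by the factor `δ * p`
  have step : ∀ M : ℝ, 0 ≤ M → (∀ i, ∀ n < 0, ‖(h i).coeff n‖ * (σ ^ p) ^ n ≤ M) →
      ∀ i, ∀ n < 0, ‖(h i).coeff n‖ * (σ ^ p) ^ n ≤ δ * p * M := by
    intro M hM0 hM i n hn
    have ha : ∀ j m, ‖negPart (interleave (c j)) m‖ * σ ^ m ≤ M := by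
      intro j
      refine hσ.norm_le_of_norm_combine_le
        ((hconv j).2.1.of_norm_le h0 (norm_negPart_le _)) fun m => ?_
      rw [combine_negPart, ← coeff_sum_phi, ← hc]
      unfold negPart
      split_ifs with hm
      -- For a negative exponent, passing from radius σ^p to the larger radius σ decreases the
      -- weight.
      · refine le_trans (mul_le_mul_of_nonneg_left ?_ (norm_nonneg _)) (hM j m hm)
        obtain ⟨k, rfl⟩ : ∃ k : ℕ, m = -k := ⟨(-m).toNat, by omega⟩
        rw [zpow_neg, zpow_neg, zpow_natCast, zpow_natCast]
        exact inv_anti₀ (by positivity) (pow_le_pow_left₀ hτ0.le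
          (pow_le_of_le_one h0.le hσ.lt_one.le hp.out.ne_zero) k)
      · simpa using hM0
    have hcr : ∀ j (r : Fin p), ‖(c j r).coeff n‖ * (σ ^ p) ^ n ≤ p * M := by
      intro j r
      have hr : ((r : ℕ) : ℤ) < p := by exact_mod_cast r.2
      have h2 : n * p + r < 0 := by nlinarith
      have h3 := ha j (n * p + r)
      rw [negPart, if_pos h2, interleave_apply, zpow_add₀ h0.ne', mul_comm n, zpow_mul,
        zpow_natCast, zpow_natCast, ← mul_assoc] at h3
      -- Returning to component exponents costs σ^(-r), which is at most p because r < p.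
      have h4 : (p : ℝ)⁻¹ ≤ σ ^ (r : ℕ) :=
        hσp.trans (pow_le_pow_of_le_one h0.le hσ.lt_one.le r.2.le)
      have hpR : (0 : ℝ) < p := by exact_mod_cast hp0
      have h5 := (mul_le_mul_of_nonneg_left h4 (by positivity)).trans h3
      rwa [← div_eq_mul_inv, div_le_iff₀ hpR, mul_comm M] at h5
    have hpn : 0 < (σ ^ p) ^ n := zpow_pos hτ0 n
    rw [hC i, ← le_div_iff₀ hpn, coeff_sum]
    refine IsUltrametricDist.norm_sum_le_of_forall_le_of_nonneg (by positivity) fun j _ => ?_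
    rw [coeff_smul, Pi.smul_apply, norm_smul, mul_assoc, mul_div_assoc]
    refine mul_le_mul (hCδ i j) ?_ (norm_nonneg _) hδ0
    rw [coeff_sum]
    refine IsUltrametricDist.norm_sum_le_of_forall_le_of_nonneg (by positivity) fun r _ => ?_
    rw [le_div_iff₀ hpn, coeff_smul, Pi.smul_apply, norm_smul, norm_pow, norm_neg, norm_one,
      one_pow, one_mul]
    exact hcr j r
  choose M hM using fun i => (hconv i).1.exists_bound
  have hM0 : ∀ i, 0 ≤ M i := fun i => le_trans (by positivity) (hM i 0)
  have iter : ∀ k : ℕ, ∀ i, ∀ n < 0,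
      ‖(h i).coeff n‖ * (σ ^ p) ^ n ≤ (δ * p) ^ k * ∑ j, M j := by
    intro k
    induction k with
    | zero =>
      intro i n _
      rw [pow_zero, one_mul]
      exact (hM i n).trans (Finset.single_le_sum (fun j _ => hM0 j) (Finset.mem_univ i))
    | succ k ih =>
      rw [pow_succ', mul_assoc]
      exact step _ (mul_nonneg (by positivity) (Finset.sum_nonneg fun j _ => hM0 j)) ih
  apply mem_plus_of_neg
  intro n hn
  -- The radius stays fixed during the iteration, so the bounds tend to 0 for each fixed negative
  -- exponent.
  have hlim : Tendsto (fun k : ℕ => (δ * p) ^ k * ∑ j, M j) atTop (𝓝 0) := by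
    simpa using (tendsto_pow_atTop_nhds_zero_of_lt_one (by positivity) hδ).mul_const (∑ j, M j)
  have hle := ge_of_tendsto' hlim fun k => iter k i n hn
  have hpn : 0 < (σ ^ p) ^ n := zpow_pos hτ0 n
  have : ‖(h i).coeff n‖ ≤ 0 := by
    by_contra hlt
    exact absurd hle (not_le.2 (mul_pos (not_le.1 hlt) hpn))
  simpa using this

/-! ### Formal properties of decompositions and of ψ. -/

/-- The sum `∑ φ(cᵢ) uⁱ`. -/
def decompSum {n : ℕ} {A : Type*} [CommRing A] (φ : A → A) (u : A) (c : Fin n → A) : A :=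
  ∑ i : Fin n, φ (c i) * u ^ (i : ℕ)

/-- Every element has a unique decomposition `∑ φ(cᵢ) uⁱ` with `n` terms. -/
def HasDecomp {A : Type*} [CommRing A] (n : ℕ) (φ : A → A) (u : A) : Prop :=
  Function.Bijective (decompSum (n := n) φ u)

theorem HasDecomp.existsUnique {p : ℕ} {A : Type*} [CommRing A] {φ : A → A} {u : A}
    (h : HasDecomp p φ u) (y : A) : ∃! c : Fin p → A, IsDecomposition φ u y c := by
  obtain ⟨c, hc, huniq⟩ := (Function.bijective_iff_existsUnique _).1 h y
  exact ⟨c, hc.symm, fun c' hc' => huniq c' hc'.symm⟩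

theorem HasDecomp.psi_decompSum {p : ℕ} [hp : Fact p.Prime] {A : Type*} [CommRing A] {φ : A → A}
    {u : A} (h : HasDecomp p φ u) (c : Fin p → A) :
    psi p φ u (decompSum φ u c) = c ⟨0, hp.out.pos⟩ := by
  have hu := h.existsUnique (decompSum φ u c)
  rw [psi, dif_pos hu]
  exact congrFun (hu.unique hu.choose_spec.1 rfl) _

theorem map_decompSum {n : ℕ} {A B : Type*} [CommRing A] [CommRing B] {φ : A → A} {φ' : B → B}
    (f : A →+* B) (hf : ∀ a, f (φ a) = φ' (f a)) (u : A) (c : Fin n → A) :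
    f (decompSum φ u c) = decompSum φ' (f u) (f ∘ c) := by
  simp [decompSum, hf]

/-- A ring map intertwining the Frobenius maps carries a decomposition to a decomposition, and
uniqueness in the target identifies the components. -/
theorem HasDecomp.map_psi {p : ℕ} [hp : Fact p.Prime] {A B : Type*} [CommRing A] [CommRing B]
    {φ : A → A} {φ' : B → B} {u : A} {u' : B} (h : HasDecomp p φ u) (h' : HasDecomp p φ' u')
    (f : A →+* B) (hf : ∀ a, f (φ a) = φ' (f a)) (hu : f u = u') (y : A) :
    psi p φ' u' (f y) = f (psi p φ u y) := by
  obtain ⟨c, rfl⟩ := h.2 y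
  rw [map_decompSum f hf, hu, h'.psi_decompSum, h.psi_decompSum]
  rfl

/-- The change of coefficients that turns `∑ φ(cᵢ) (1 + x)ⁱ` into `∑ φ(dᵢ) xⁱ`. -/
noncomputable def shiftEquiv (n : ℕ) (A : Type*) [CommRing A] : (Fin n → A) ≃ₗ[A] (Fin n → A) :=
  (Polynomial.degreeLTEquiv A n).symm.trans
    ((Polynomial.taylorLinearEquiv 1 n).trans (Polynomial.degreeLTEquiv A n))

theorem decompSum_degreeLTEquiv {n : ℕ} {A : Type*} [CommRing A] (φ : A →+* A) (x : A)
    (P : Polynomial.degreeLT A n) :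
    decompSum φ x (Polynomial.degreeLTEquiv A n P) = P.1.eval₂ φ x := by
  rw [Polynomial.eval₂_eq_sum]
  exact Polynomial.sum_fin (fun i a => φ a * x ^ i) (by simp) (Polynomial.mem_degreeLT.1 P.2)

/-- Read c as a polynomial P of degree < n; the sum is then P evaluated along φ, and the shift
replaces P(T) by P(T + 1). -/
theorem decompSum_shiftEquiv {n : ℕ} {A : Type*} [CommRing A] (φ : A →+* A) (x : A)
    (c : Fin n → A) : decompSum φ x (shiftEquiv n A c) = decompSum φ (1 + x) c := by
  obtain ⟨P, rfl⟩ := (Polynomial.degreeLTEquiv A n).surjective c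
  simp only [shiftEquiv, LinearEquiv.trans_apply, LinearEquiv.symm_apply_apply,
    decompSum_degreeLTEquiv]
  rw [Polynomial.taylorLinearEquiv_apply_coe]
  show Polynomial.eval₂ φ x (Polynomial.taylor 1 P.1) = _
  rw [Polynomial.taylor_apply, Polynomial.eval₂_comp]
  simp [add_comm]

/-- The previous identity for φ = id and x = -1: P(1 + x) becomes P(0). It expresses ψ through the
components relative to powers of X. -/
theorem sum_neg_one_pow_shiftEquiv {n : ℕ} {A : Type*} [CommRing A] (hn : 0 < n) (c : Fin n → A) :
    ∑ i : Fin n, shiftEquiv n A c i * (-1) ^ (i : ℕ) = c ⟨0, hn⟩ := by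
  have h := decompSum_shiftEquiv (RingHom.id A) (-1) c
  simp only [decompSum, RingHom.id_apply, add_neg_cancel] at h
  rw [h, Finset.sum_eq_single ⟨0, hn⟩]
  · simp
  · intro i _ hi
    have : (i : ℕ) ≠ 0 := fun h0 => hi (Fin.ext h0)
    simp [this]
  · simp

theorem HasDecomp.one_add {n : ℕ} {A : Type*} [CommRing A] {φ : A →+* A} {x : A}
    (h : HasDecomp n φ x) : HasDecomp n φ (1 + x) := by
  have e : decompSum (n := n) φ (1 + x) = decompSum φ x ∘ shiftEquiv n A :=
    funext fun c => (decompSum_shiftEquiv φ x c).symm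
  unfold HasDecomp
  rw [e]
  exact h.comp (shiftEquiv n A).bijective

/-- `decompSum` as a linear map. -/
def decompLinearMap {K A : Type*} [CommRing K] [CommRing A] [Algebra K A] (n : ℕ)
    (φ : A →ₐ[K] A) (u : A) : (Fin n → A) →ₗ[K] A where
  toFun := decompSum φ u
  map_add' c d := by simp [decompSum, add_mul, Finset.sum_add_distrib]
  map_smul' r c := by simp [decompSum, Finset.smul_sum]

/-- A decomposition is a K-linear isomorphism Aⁿ ≃ A; tensor it with E and identify E ⊗ Aⁿ with (E ⊗
A)ⁿ. -/
theorem HasDecomp.tensor {n : ℕ} {K E A : Type*} [Field K] [CommRing E] [Algebra K E] [CommRing A]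
    [Algebra K A] {φ : A →ₐ[K] A} {u : A} (h : HasDecomp n φ u) :
    HasDecomp n (Algebra.TensorProduct.map (AlgHom.id E E) φ) ((1 : E) ⊗ₜ[K] u) := by
  let D : (Fin n → A) ≃ₗ[K] A := LinearEquiv.ofBijective (decompLinearMap n φ u) h
  have key : ∀ z : E ⊗[K] (Fin n → A),
      decompSum (Algebra.TensorProduct.map (AlgHom.id E E) φ) ((1 : E) ⊗ₜ[K] u)
        (TensorProduct.piRight K K E (fun _ : Fin n => A) z) = LinearEquiv.lTensor E D z := by
    intro z
    induction z with
    | zero => simp [decompSum]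
    | add x y hx hy =>
      rw [map_add, map_add, ← hx, ← hy]
      simp only [decompSum, Pi.add_apply, map_add, add_mul, Finset.sum_add_distrib]
    | tmul e c =>
      rw [LinearEquiv.lTensor_tmul]
      have hD : D c = ∑ i : Fin n, φ (c i) * u ^ (i : ℕ) := rfl
      rw [hD, TensorProduct.tmul_sum, TensorProduct.piRight_apply]
      simp [decompSum, Algebra.TensorProduct.tmul_pow]
  have e : decompSum (n := n) (Algebra.TensorProduct.map (AlgHom.id E E) φ) ((1 : E) ⊗ₜ[K] u) =
      LinearEquiv.lTensor E D ∘ (TensorProduct.piRight K K E (fun _ : Fin n => A)).symm := by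
    funext c
    rw [Function.comp, ← key, LinearEquiv.apply_symm_apply]
  unfold HasDecomp
  rw [e]
  exact (LinearEquiv.bijective _).comp (LinearEquiv.bijective _)

/-! ### Decompositions in a localization. -/

theorem exists_common_denominator {ι A B : Type*} [Finite ι] [CommRing A] [CommRing B]
    [Algebra A B] (s : A) [IsLocalization.Away s B] (f : ι → B) :
    ∃ (m : ℕ) (a : ι → A), ∀ i, f i * algebraMap A B s ^ m = algebraMap A B (a i) := by
  have := Fintype.ofFinite ι
  choose m a h using fun i => IsLocalization.Away.surj s (f i)
  refine ⟨Finset.univ.sup m, fun i => a i * s ^ (Finset.univ.sup m - m i), fun i => ?_⟩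
  rw [map_mul, map_pow, ← h i, mul_assoc, ← pow_add,
    Nat.add_sub_cancel' (Finset.le_sup (Finset.mem_univ i))]

theorem exists_pow_mul_eq {ι A B : Type*} [Finite ι] [CommRing A] [CommRing B]
    [Algebra A B] (s : A) [IsLocalization.Away s B] {a b : ι → A}
    (h : ∀ i, algebraMap A B (a i) = algebraMap A B (b i)) :
    ∃ m : ℕ, ∀ k, m ≤ k → ∀ i, s ^ k * a i = s ^ k * b i := by
  have := Fintype.ofFinite ι
  choose m h using fun i => IsLocalization.Away.exists_of_eq s (h i)
  refine ⟨Finset.univ.sup m, fun k hk i => ?_⟩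
  have hi : m i ≤ k := (Finset.le_sup (Finset.mem_univ i)).trans hk
  rw [← Nat.sub_add_cancel hi, pow_add, mul_assoc, mul_assoc, h i]

theorem phi_pow_mul {K A : Type*} [CommRing K] [CommRing A] [Algebra K A] {φ : A →ₐ[K] A} {s : A}
    {k : K} (hs : φ s = k • s) (m : ℕ) (a : A) : φ (s ^ m * a) = k ^ m • (s ^ m * φ a) := by
  rw [map_mul, map_pow, hs, smul_pow, smul_mul_assoc]

/-- Since φ(s) = ks, pulling s^m inside φ costs k^m. With s = t and k = p, this is the source of the
powers of p that make matrices small. -/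
theorem decompSum_pow_mul {K A : Type*} [Field K] [CommRing A] [Algebra K A] {n : ℕ}
    {φ : A →ₐ[K] A} {s : A} {k : K} (hk : k ≠ 0) (hs : φ s = k • s) (u : A) (m : ℕ)
    (c : Fin n → A) :
    decompSum φ u (fun i => (k ^ m)⁻¹ • (s ^ m * c i)) = s ^ m * decompSum φ u c := by
  unfold decompSum
  rw [Finset.mul_sum]
  refine Finset.sum_congr rfl fun i _ => ?_
  rw [map_smul, phi_pow_mul hs, inv_smul_smul₀ (pow_ne_zero m hk), mul_assoc]

theorem map_decompSum_localization {K A B : Type*} [Field K] [CommRing A] [CommRing B] [Algebra K A]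
    [Algebra K B] [Algebra A B] {n : ℕ} {φ : A →ₐ[K] A} {Φ : B →ₐ[K] B}
    (hΦ : ∀ a, Φ (algebraMap A B a) = algebraMap A B (φ a)) (u : A) (c : Fin n → A) :
    algebraMap A B (decompSum φ u c) =
      decompSum Φ (algebraMap A B u) (fun i => algebraMap A B (c i)) :=
  map_decompSum (algebraMap A B) (fun a => (hΦ a).symm) u c

/-- Clear denominators by a power of s, decompose in A, and divide back, correcting by the power of
k from φ(s^m) = k^m s^m. -/
theorem HasDecomp.localization {K A B : Type*} [Field K] [CommRing A] [CommRing B] [Algebra K A]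
    [Algebra K B] [Algebra A B] [IsScalarTower K A B] {n : ℕ} {φ : A →ₐ[K] A} {Φ : B →ₐ[K] B}
    (hΦ : ∀ a, Φ (algebraMap A B a) = algebraMap A B (φ a)) {s u : A} [IsLocalization.Away s B]
    {k : K} (hk : k ≠ 0) (hs : φ s = k • s) (h : HasDecomp n φ u) :
    HasDecomp n Φ (algebraMap A B u) := by
  have hunit := fun m => IsLocalization.Away.algebraMap_pow_isUnit (S := B) s m
  have hΦs : Φ (algebraMap A B s) = k • algebraMap A B s := by
    rw [hΦ, hs, Algebra.algebraMap_eq_smul_one (R := A), smul_assoc,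
      Algebra.algebraMap_eq_smul_one (R := A)]
  constructor
  · refine (injective_iff_map_eq_zero (decompLinearMap n Φ (algebraMap A B u))).2 fun c hc => ?_
    obtain ⟨m, a, ha⟩ := exists_common_denominator s c
    have h1 : algebraMap A B (decompSum φ u fun i => (k ^ m)⁻¹ • a i) = algebraMap A B 0 := by
      rw [map_decompSum_localization hΦ, map_zero, ← mul_zero (algebraMap A B s ^ m)]
      rw [← show decompSum Φ (algebraMap A B u) c = 0 from hc, ← decompSum_pow_mul hk hΦs]
      congr 1
      funext i
      rw [mul_comm _ (c i), ha]
      exact map_smul (IsScalarTower.toAlgHom K A B) _ _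
    -- No regularity of s is assumed, so the equation returns to A only after multiplication by a
    -- further power of s.
    obtain ⟨l, hl⟩ := IsLocalization.Away.exists_of_eq s h1
    rw [mul_zero, ← decompSum_pow_mul hk hs] at hl
    have h2 := (injective_iff_map_eq_zero (decompLinearMap n φ u)).1 h.1 _ hl
    funext i
    have h3 : s ^ l * a i = 0 := by
      have h4 := congrFun h2 i
      simp only [Pi.zero_apply, mul_smul_comm] at h4
      rwa [smul_smul, smul_eq_zero_iff_right
        (mul_ne_zero (inv_ne_zero (pow_ne_zero _ hk)) (inv_ne_zero (pow_ne_zero _ hk)))] at h4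
    have h5 := congrArg (algebraMap A B) h3
    rw [map_mul, map_pow, ← ha, map_zero] at h5
    rwa [(hunit l).mul_right_eq_zero, (hunit m).mul_left_eq_zero] at h5
  · intro y
    obtain ⟨m, a, ha⟩ := IsLocalization.Away.surj s y
    obtain ⟨c, rfl⟩ := h.2 a
    obtain ⟨v, hv⟩ := (hunit m).exists_right_inv
    refine ⟨fun i => k ^ m • (v * algebraMap A B (c i)), (hunit m).mul_left_cancel ?_⟩
    rw [mul_comm _ y, ha, map_decompSum_localization hΦ, ← decompSum_pow_mul hk hΦs]
    congr 1
    funext i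
    rw [mul_smul_comm, inv_smul_smul₀ (pow_ne_zero _ hk), ← mul_assoc, hv, one_mul]

/-! ### Decompositions over R, R⁺ and their extensions. -/

theorem hasDecomp_phi (p : ℕ) [hp : Fact p.Prime] : HasDecomp p (phi p) (1 + X p) :=
  HasDecomp.one_add (φ := (phi p : Robba p →+* Robba p)) (bijective_sum_phi p)

/-- Uniqueness is inherited from R; for existence, the components in R of an element of R⁺ lie in
R⁺. -/
theorem hasDecomp_phiPlus (p : ℕ) [hp : Fact p.Prime] :
    HasDecomp p (phiPlus p) (onePlusX p) := by
  have hX : X p ∈ plus p := mem_plus_of_neg fun n hn => by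
    show (Pi.single 1 1 : ℤ → ℚ_[p]) n = 0
    exact Pi.single_eq_of_ne (by omega) _
  have e : onePlusX p = 1 + ⟨X p, hX⟩ := rfl
  rw [e]
  refine HasDecomp.one_add (φ := (phiPlus p : plus p →+* plus p)) ?_
  have hval : ∀ c : Fin p → plus p, ((decompSum (phiPlus p) ⟨X p, hX⟩ c : plus p) : Robba p) =
      decompSum (phi p) (X p) (fun i => (c i : Robba p)) := fun c =>
    map_decompSum ((plus p).val : plus p →+* Robba p) (fun _ => rfl) _ c
  constructor
  · intro c c' h
    have h2 := congrArg (Subtype.val) h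
    have h3 := (bijective_sum_phi p).1 ((hval c).symm.trans (h2.trans (hval c')))
    funext i
    exact Subtype.ext (congrFun h3 i)
  · intro f
    obtain ⟨c, hc⟩ := (bijective_sum_phi p).2 f
    have hm : ∀ i, c i ∈ plus p := by
      have hf := f.2
      rw [← hc] at hf
      exact mem_plus_of_sum_phi_mem hf
    refine ⟨fun i => ⟨c i, hm i⟩, Subtype.ext ?_⟩
    exact (hval _).trans hc

theorem phiInvT_algebraMap (p : ℕ) [Fact p.Prime] (a : Robba p) :
    phiInvT p (algebraMap (Robba p) (InvT p) a) = algebraMap (Robba p) (InvT p) (phi p a) := by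
  rw [phiInvT, IsLocalization.Away.liftAlgHom_apply, IsLocalization.Away.lift_eq]
  rfl

theorem phiPlusInvT_algebraMap (p : ℕ) [Fact p.Prime] (a : plus p) :
    phiPlusInvT p (algebraMap (plus p) (PlusInvT p) a) =
      algebraMap (plus p) (PlusInvT p) (phiPlus p a) := by
  rw [phiPlusInvT, IsLocalization.Away.liftAlgHom_apply, IsLocalization.Away.lift_eq]
  rfl

theorem inclInvT_algebraMap (p : ℕ) [Fact p.Prime] (a : plus p) :
    inclInvT p (algebraMap (plus p) (PlusInvT p) a) = algebraMap (Robba p) (InvT p) a := by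
  exact IsLocalization.Away.lift_eq (tPlus p)
    (g := (((IsScalarTower.toAlgHom ℚ_[p] (Robba p) (InvT p)).comp (plus p).val :
      plus p →ₐ[ℚ_[p]] InvT p) : plus p →+* InvT p))
    (IsLocalization.Away.algebraMap_isUnit (t p)) a

theorem natCast_ne_zero (p : ℕ) [hp : Fact p.Prime] : (p : ℚ_[p]) ≠ 0 := by
  exact_mod_cast hp.out.ne_zero

theorem hasDecomp_phiInvT (p : ℕ) [Fact p.Prime] :
    HasDecomp p (phiInvT p) (algebraMap (Robba p) (InvT p) (1 + X p)) :=
  HasDecomp.localization (phiInvT_algebraMap p) (natCast_ne_zero p) (phi_t p) (hasDecomp_phi p)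

theorem hasDecomp_phiPlusInvT (p : ℕ) [Fact p.Prime] :
    HasDecomp p (phiPlusInvT p) (algebraMap (plus p) (PlusInvT p) (onePlusX p)) :=
  HasDecomp.localization (phiPlusInvT_algebraMap p) (natCast_ne_zero p) (phiPlus_t p)
    (hasDecomp_phiPlus p)

theorem hasDecomp_phiE (p : ℕ) [Fact p.Prime] (E : Type*) [Field E] [Algebra ℚ_[p] E] :
    HasDecomp p (phiE p E) (uE p E) :=
  (hasDecomp_phiInvT p).tensor

theorem hasDecomp_phiPlusE (p : ℕ) [Fact p.Prime] (E : Type*) [Field E] [Algebra ℚ_[p] E] :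
    HasDecomp p (phiPlusE p E) (uPlusE p E) :=
  (hasDecomp_phiPlusInvT p).tensor

/-! ### The natural map and its compatibility with ψ. -/

/-- If a power of t kills the numerator in R, it already does so in the subring R⁺. -/
theorem inclInvT_injective (p : ℕ) [Fact p.Prime] : Function.Injective (inclInvT p) := by
  refine (injective_iff_map_eq_zero (inclInvT p)).2 fun y hy => ?_
  have hunit := fun m => IsLocalization.Away.algebraMap_pow_isUnit (S := PlusInvT p) (tPlus p) m
  obtain ⟨m, a, ha⟩ := IsLocalization.Away.surj (tPlus p) y
  have h1 := congrArg (inclInvT p) ha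
  rw [map_mul, hy, zero_mul, inclInvT_algebraMap, ← map_zero (algebraMap (Robba p) (InvT p))] at h1
  obtain ⟨l, hl⟩ := IsLocalization.Away.exists_of_eq (t p) h1
  rw [mul_zero] at hl
  have h2 : tPlus p ^ l * a = 0 := Subtype.ext hl.symm
  have h3 := congrArg (algebraMap (plus p) (PlusInvT p)) h2
  rwa [map_mul, map_pow, ← ha, map_zero, (hunit l).mul_right_eq_zero,
    (hunit m).mul_left_eq_zero] at h3

theorem inclE_injective (p : ℕ) [Fact p.Prime] (E : Type*) [Field E] [Algebra ℚ_[p] E] :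
    Function.Injective (inclE p E) :=
  Module.Flat.lTensor_preserves_injective_linearMap (M := E) (inclInvT p).toLinearMap
    (inclInvT_injective p)

theorem inclE_phiPlusE (p : ℕ) [Fact p.Prime] (E : Type*) [Field E] [Algebra ℚ_[p] E]
    (a : E ⊗[ℚ_[p]] PlusInvT p) : inclE p E (phiPlusE p E a) = phiE p E (inclE p E a) := by
  have h : (inclInvT p).comp (phiPlusInvT p) = (phiInvT p).comp (inclInvT p) := by
    apply AlgHom.coe_ringHom_injective
    apply IsLocalization.ringHom_ext (Submonoid.powers (tPlus p))
    ext x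
    show inclInvT p (phiPlusInvT p (algebraMap _ _ x)) = phiInvT p (inclInvT p (algebraMap _ _ x))
    rw [phiPlusInvT_algebraMap, inclInvT_algebraMap, inclInvT_algebraMap, phiInvT_algebraMap]
    rfl
  induction a with
  | zero => simp
  | add x y hx hy => rw [map_add, map_add, hx, hy, map_add, map_add]
  | tmul e x =>
    simp only [inclE, phiPlusE, phiE, Algebra.TensorProduct.map_tmul]
    congr 1
    exact DFunLike.congr_fun h x

theorem inclE_uPlusE (p : ℕ) [Fact p.Prime] (E : Type*) [Field E] [Algebra ℚ_[p] E] :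
    inclE p E (uPlusE p E) = uE p E := by
  rw [inclE, uPlusE, uE, Algebra.TensorProduct.map_tmul, inclInvT_algebraMap]
  rfl

theorem psiE_inclE (p : ℕ) [Fact p.Prime] (E : Type*) [Field E] [Algebra ℚ_[p] E]
    (a : E ⊗[ℚ_[p]] PlusInvT p) : psiE p E (inclE p E a) = inclE p E (psiPlusE p E a) :=
  (hasDecomp_phiPlusE p E).map_psi (hasDecomp_phiE p E) (inclE p E).toRingHom
    (inclE_phiPlusE p E) (inclE_uPlusE p E) a

/-! ### From eigenvectors of ψ to matrix equations. -/

/-- Solutions of `f = B ψ(f)` with a constant matrix `B`, up to multiplication by a power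
of `t`. -/
theorem exists_pow_mul_mem_plus {p : ℕ} [hp : Fact p.Prime] {ι : Type*} [Fintype ι]
    {c : ι → Fin p → Robba p} {B : ι → ι → ℚ_[p]} {n₀ : ℕ}
    (h : ∀ n, n₀ ≤ n → ∀ i, t p ^ n * decompSum (phi p) (1 + X p) (c i) =
      t p ^ n * ∑ j, B i j • c j ⟨0, hp.out.pos⟩) :
    ∃ n, ∀ i, t p ^ n * decompSum (phi p) (1 + X p) (c i) ∈ plus p := by
  have hp0 := natCast_ne_zero p
  have hpR : (0 : ℝ) < p := by exact_mod_cast hp.out.pos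
  set M : ℝ := ∑ i, ∑ j, ‖B i j‖ with hM
  have hBM : ∀ i j, ‖B i j‖ ≤ M := fun i j =>
    (Finset.single_le_sum (f := fun j => ‖B i j‖) (fun _ _ => norm_nonneg _)
      (Finset.mem_univ j)).trans
      (Finset.single_le_sum (f := fun i => ∑ j, ‖B i j‖)
        (fun _ _ => Finset.sum_nonneg fun _ _ => norm_nonneg _) (Finset.mem_univ i))
  have hlim : Tendsto (fun n : ℕ => (p : ℝ)⁻¹ ^ n * M * p) atTop (𝓝 0) := by
    simpa using ((tendsto_pow_atTop_nhds_zero_of_lt_one (by positivity)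
      (inv_lt_one_of_one_lt₀ (by exact_mod_cast hp.out.one_lt))).mul_const M).mul_const (p : ℝ)
  -- Two demands on n: the entries of p^n B, of norm at most p^(-n) M, must be smaller than 1/p, and
  -- n ≥ n₀ so that the given relation holds.
  obtain ⟨n, hn1, hn⟩ := ((hlim.eventually (gt_mem_nhds one_pos)).and
    (eventually_ge_atTop n₀)).exists
  -- The components of t^n f are p^(-n) t^n c, rewritten relative to powers of X; the compensating
  -- p^n goes into the matrix.
  refine ⟨n, mem_plus_of_small_matrix
    (c := fun i => shiftEquiv p (Robba p) fun r => ((p : ℚ_[p]) ^ n)⁻¹ • (t p ^ n * c i r))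
    (C := fun i j => (p : ℚ_[p]) ^ n * B i j) (fun i => ?_) (fun i => ?_) hn1 fun i j => ?_⟩
  · rw [← decompSum_pow_mul hp0 (phi_t p)]
    exact (decompSum_shiftEquiv (phi p : Robba p →+* Robba p) (X p) _).symm
  · rw [h n hn, Finset.mul_sum]
    refine Finset.sum_congr rfl fun j _ => ?_
    have h1 := sum_neg_one_pow_shiftEquiv hp.out.pos
      fun r => ((p : ℚ_[p]) ^ n)⁻¹ • (t p ^ n * c j r)
    have h2 : ∀ (r : Fin p) (x : Robba p),
        (-1 : ℚ_[p]) ^ (r : ℕ) • x = x * (-1) ^ (r : ℕ) := by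
      intro r x
      rw [Algebra.smul_def, map_pow, map_neg, map_one, mul_comm]
    simp only [h2]
    rw [h1, smul_smul, mul_right_comm, mul_inv_cancel₀ (pow_ne_zero n hp0), one_mul,
      mul_smul_comm]
  · rw [norm_mul, norm_pow, Padic.norm_p]
    exact mul_le_mul_of_nonneg_left (hBM i j) (by positivity)

/-- Clearing denominators by t^m replaces B by p^m B. The resulting equation holds in R after
multiplication by large powers of t, and dividing by t^(n+m) in R⁺[1/t] recovers f. -/
theorem mem_range_inclInvT {p : ℕ} [hp : Fact p.Prime] {ι : Type*} [Fintype ι]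
    {f : ι → InvT p} {B : ι → ι → ℚ_[p]}
    (h : ∀ i, f i = ∑ j, B i j •
      psi p (phiInvT p) (algebraMap (Robba p) (InvT p) (1 + X p)) (f j)) (i : ι) :
    f i ∈ (inclInvT p).range := by
  have hp0 := natCast_ne_zero p
  set σ := algebraMap (Robba p) (InvT p) (t p) with hσ
  have hunit := fun m => IsLocalization.Away.algebraMap_pow_isUnit (S := InvT p) (t p) m
  have hσφ : phiInvT p σ = (p : ℚ_[p]) • σ := by
    rw [hσ, phiInvT_algebraMap, phi_t]
    exact map_smul (IsScalarTower.toAlgHom ℚ_[p] (Robba p) (InvT p)) _ _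
  obtain ⟨m, a, ha⟩ := exists_common_denominator (t p) f
  choose c hc using fun i => (hasDecomp_phi p).2 (a i)
  obtain ⟨v, hv⟩ := (hunit m).exists_right_inv
  have hpsi : ∀ j, σ ^ m * psi p (phiInvT p) (algebraMap (Robba p) (InvT p) (1 + X p)) (f j) =
      (p : ℚ_[p]) ^ m • algebraMap (Robba p) (InvT p) (c j ⟨0, hp.out.pos⟩) := by
    intro j
    have hf : f j = decompSum (phiInvT p) (algebraMap (Robba p) (InvT p) (1 + X p))
        fun r => (p : ℚ_[p]) ^ m • (v * algebraMap (Robba p) (InvT p) (c j r)) := by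
      refine (hunit m).mul_left_cancel ?_
      rw [mul_comm _ (f j), ha, ← hc, map_decompSum_localization (phiInvT_algebraMap p),
        ← decompSum_pow_mul hp0 hσφ]
      congr 1
      funext r
      rw [mul_smul_comm, inv_smul_smul₀ (pow_ne_zero _ hp0), ← mul_assoc, hv, one_mul]
    rw [hf, (hasDecomp_phiInvT p).psi_decompSum, mul_smul_comm, ← mul_assoc, hv, one_mul]
  have heq : ∀ i, algebraMap (Robba p) (InvT p) (decompSum (phi p) (1 + X p) (c i)) =
      algebraMap (Robba p) (InvT p)
        (∑ j, (B i j * (p : ℚ_[p]) ^ m) • c j ⟨0, hp.out.pos⟩) := by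
    intro i
    rw [hc, ← ha, h i, mul_comm, Finset.mul_sum, map_sum]
    refine Finset.sum_congr rfl fun j _ => ?_
    rw [mul_smul_comm, hpsi, smul_smul]
    exact (map_smul (IsScalarTower.toAlgHom ℚ_[p] (Robba p) (InvT p)) _ _).symm
  obtain ⟨n₀, hn₀⟩ := exists_pow_mul_eq (t p) heq
  obtain ⟨n, hn⟩ := exists_pow_mul_mem_plus hn₀
  obtain ⟨w, hw⟩ := (IsLocalization.Away.algebraMap_pow_isUnit (S := PlusInvT p)
    (tPlus p) (n + m)).exists_right_inv
  refine ⟨algebraMap (plus p) (PlusInvT p) ⟨_, hn i⟩ * w, (hunit (n + m)).mul_left_cancel ?_⟩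
  have hw2 := congrArg (inclInvT p) hw
  rw [map_mul, map_pow, inclInvT_algebraMap, map_one] at hw2
  show _ * inclInvT p _ = _
  rw [map_mul, inclInvT_algebraMap, mul_left_comm]
  have e : algebraMap (Robba p) (InvT p) (t p) = algebraMap (Robba p) (InvT p) (tPlus p) := rfl
  rw [e, hw2, mul_one, ← e, pow_add, mul_assoc, mul_comm _ (f i), ha, ← hc, map_mul, map_pow]

/-- Decomposing each `f i` and tensoring with `b i` decomposes the whole sum, so ψ on E ⊗ R[1/t] is
id ⊗ ψ. -/
theorem psiE_sum {p : ℕ} [hp : Fact p.Prime] {E : Type*} [Field E] [Algebra ℚ_[p] E]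
    {ι : Type*} (s : Finset ι) (b : ι → E) (f : ι → InvT p) :
    psiE p E (∑ i ∈ s, b i ⊗ₜ f i) = ∑ i ∈ s, b i ⊗ₜ
      psi p (phiInvT p) (algebraMap (Robba p) (InvT p) (1 + X p)) (f i) := by
  choose c hc using fun i => (hasDecomp_phiInvT p).2 (f i)
  have h : ∑ i ∈ s, b i ⊗ₜ f i = decompSum (phiE p E) (uE p E)
      fun r => ∑ i ∈ s, b i ⊗ₜ[ℚ_[p]] c i r := by
    simp only [decompSum, map_sum, Finset.sum_mul]
    rw [Finset.sum_comm]
    refine Finset.sum_congr rfl fun i _ => ?_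
    rw [← hc i]
    simp [decompSum, TensorProduct.tmul_sum, phiE, uE, Algebra.TensorProduct.tmul_pow]
  rw [psiE, h, (hasDecomp_phiE p E).psi_decompSum]
  refine Finset.sum_congr rfl fun i _ => ?_
  rw [← hc i, (hasDecomp_phiInvT p).psi_decompSum]

/-- As α is invertible, f = α⁻¹ψ(f). In a finite basis of E this is a system c = Bψ(c) with B over
ℚ_p, to which the matrix result applies coordinate by coordinate. -/
theorem mem_range_inclE {p : ℕ} [hp : Fact p.Prime] {E : Type*} [Field E] [Algebra ℚ_[p] E]
    [FiniteDimensional ℚ_[p] E] {α : E} (hα : α ≠ 0) {f : E ⊗[ℚ_[p]] InvT p}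
    (hf : psiE p E f = α • f) : ∃ g, inclE p E g = f := by
  classical
  let b := Module.finBasis ℚ_[p] E
  obtain ⟨c, rfl⟩ := TensorProduct.eq_repr_basis_left b f
  rw [Finsupp.sum_fintype _ _ (fun i => TensorProduct.tmul_zero _ _)] at hf ⊢
  set ψ := psi p (phiInvT p) (algebraMap (Robba p) (InvT p) (1 + X p)) with hψ
  have hinv : ∑ j, b j ⊗ₜ[ℚ_[p]] c j = ∑ j, (α⁻¹ * b j) ⊗ₜ[ℚ_[p]] ψ (c j) := by
    rw [psiE_sum] at hf
    rw [← inv_smul_smul₀ hα (∑ j, b j ⊗ₜ[ℚ_[p]] c j), ← hf, Finset.smul_sum]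
    rfl
  have hcoef : ∀ i, c i = ∑ j, b.repr (α⁻¹ * b j) i • ψ (c j) := by
    intro i
    have h1 := congrArg (fun z => TensorProduct.equivFinsuppOfBasisLeft b z i) hinv
    simp only [map_sum, Finsupp.finsetSum_apply,
      TensorProduct.equivFinsuppOfBasisLeft_apply_tmul_apply, Module.Basis.repr_self] at h1
    rw [← h1]
    simp [Finsupp.single_apply]
  choose g hg using fun i => mem_range_inclInvT (f := c)
    (B := fun i j => b.repr (α⁻¹ * b j) i) hcoef i
  refine ⟨∑ j, b j ⊗ₜ g j, ?_⟩
  rw [map_sum]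
  refine Finset.sum_congr rfl fun j _ => ?_
  rw [← hg j]
  rfl

end Robba

theorem mainTheorem12 (p : ℕ) [Fact p.Prime] (E : Type*) [Field E] [Algebra ℚ_[p] E]
    [FiniteDimensional ℚ_[p] E] (α : E) (hα : α ≠ 0) :
    (∀ y : E ⊗[ℚ_[p]] Robba.InvT p, ∃! c : Fin p → E ⊗[ℚ_[p]] Robba.InvT p,
      Robba.IsDecomposition (Robba.phiE p E) (Robba.uE p E) y c) ∧
    (∀ y : E ⊗[ℚ_[p]] Robba.PlusInvT p, ∃! c : Fin p → E ⊗[ℚ_[p]] Robba.PlusInvT p,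
      Robba.IsDecomposition (Robba.phiPlusE p E) (Robba.uPlusE p E) y c) ∧
    Function.Injective (Robba.inclE p E) ∧
    {f : E ⊗[ℚ_[p]] Robba.InvT p | Robba.psiE p E f = α • f} =
      Robba.inclE p E '' {g : E ⊗[ℚ_[p]] Robba.PlusInvT p | Robba.psiPlusE p E g = α • g} := by
  refine ⟨(Robba.hasDecomp_phiE p E).existsUnique, (Robba.hasDecomp_phiPlusE p E).existsUnique,
    Robba.inclE_injective p E, Set.Subset.antisymm ?_ ?_⟩
  · intro f hf
    obtain ⟨g, rfl⟩ := Robba.mem_range_inclE hα hf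
    -- The eigenvector equation for the preimage follows from injectivity and compatibility with ψ.
    refine ⟨g, Robba.inclE_injective p E ?_, rfl⟩
    rw [← Robba.psiE_inclE, map_smul]
    exact hf
  · rintro _ ⟨g, hg, rfl⟩
    show Robba.psiE p E (Robba.inclE p E g) = α • Robba.inclE p E g
    rw [Robba.psiE_inclE, show Robba.psiPlusE p E g = α • g from hg, map_smul]
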